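/- For $\epsilon>0$ let $\rho_\epsilon(x)=2+\sin\!\big(2\pi(x+\tfrac12)/\epsilon\big)$ on $[-\tfrac12,\tfrac12]$, and let $E_n(\epsilon)$, $n=1,2,\dots$, be the $n$-th eigenvalue, in increasing order, of the Dirichlet problem $$-\psi''(x)=E\,\rho_\epsilon(x)\,\psi(x),\qquad \psi(-\tfrac12)=\psi(\tfrac12)=0 .$$ That is, $E_n(\epsilon)$ is the eigenvalue that has exactly $n-1$ eigenvalues strictly below it. Then, for every fixed $n\ge 1$, $E_n(\epsilon)$ exists for all sufficiently small $\epsilon>0$, and as $\epsilon\to0^+$: 1. The fundamental eigenvalue satisfies $$E_1(\epsilon)=\frac{\pi^2}{2}-\frac{\pi^2}{64}\epsilon^2+\frac{\pi}{4}\sin^2\!\Big(\frac{\pi}{\epsilon}\Big)\epsilon^3-\frac{15\pi^2}{1024}\epsilon^4+\frac{\pi\big(5\sin\frac{4\pi}{\epsilon}-116\cos\frac{2\pi}{\epsilon}+116\big)}{1024}\,\epsilon^5+O(\epsilon^6).$$ 2. For every fixed $n\ge1$ (with the constants in the $O$ terms allowed to depend on $n$), $$E_n(\epsilon)=\frac{\pi^2n^2}{2}-\frac{\pi^2n^4}{64}\epsilon^2+\frac{\pi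 n^4}{4}\sin^2\!\Big(\frac{\pi}{\epsilon}\Big)\epsilon^3+O(\epsilon^4),$$ $$\sqrt{E_n(\epsilon)}=\frac{\pi n}{\sqrt2}-\frac{\pi n^3}{64\sqrt2}\,\epsilon^2+\frac{n^3\sin^2(\pi/\epsilon)}{4\sqrt2}\,\epsilon^3+O(\epsilon^4).$$ -/

import Mathlib

open Filter Topology Asymptotics

noncomputable section

/-- `E` is an eigenvalue of the string of density `ρ` on `[-L, L]` with fixed ends: the problem
`-ψ'' = E ρ ψ`, `ψ (-L) = ψ L = 0` has a solution `ψ`, twice differentiable on `[-L, L]` (one-sided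
at the end points) with first derivative `φ`, which does not vanish identically on `[-L, L]`. -/
def IsStringEigenvalue (L : ℝ) (ρ : ℝ → ℝ) (E : ℝ) : Prop :=
  ∃ ψ φ : ℝ → ℝ,
    (∀ x ∈ Set.Icc (-L) L, HasDerivWithinAt ψ (φ x) (Set.Icc (-L) L) x) ∧
    (∀ x ∈ Set.Icc (-L) L, HasDerivWithinAt φ (-(E * ρ x * ψ x)) (Set.Icc (-L) L) x) ∧
    ψ (-L) = 0 ∧ ψ L = 0 ∧
    ∃ x ∈ Set.Icc (-L) L, ψ x ≠ 0

/-- `E` is the `n`-th eigenvalue (`n = 1, 2, …`, increasing order): it is an eigenvalue and exactly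
`n - 1` eigenvalues lie strictly below it. (All eigenvalues of such a problem are simple, so that
counting them as a set is the same as counting them with multiplicity.) -/
def IsNthStringEigenvalue (L : ℝ) (ρ : ℝ → ℝ) (n : ℕ) (E : ℝ) : Prop :=
  IsStringEigenvalue L ρ E ∧ {E' : ℝ | IsStringEigenvalue L ρ E' ∧ E' < E}.encard + 1 = n

/-- There is at most one `n`-th eigenvalue. -/
theorem IsNthStringEigenvalue.unique {L : ℝ} {ρ : ℝ → ℝ} {n : ℕ} {E F : ℝ}
    (hE : IsNthStringEigenvalue L ρ n E) (hF : IsNthStringEigenvalue L ρ n F) : E = F := by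
  have key : ∀ {A B : ℝ}, IsNthStringEigenvalue L ρ n A → IsNthStringEigenvalue L ρ n B →
      ¬ A < B := by
    intro A B hA hB hlt
    have hfin : {E' : ℝ | IsStringEigenvalue L ρ E' ∧ E' < A}.Finite := by
      rw [← Set.encard_ne_top_iff]
      intro h
      have h2 := hA.2
      rw [h] at h2
      simp at h2
    have hss : {E' : ℝ | IsStringEigenvalue L ρ E' ∧ E' < A} ⊂
        {E' : ℝ | IsStringEigenvalue L ρ E' ∧ E' < B} := by
      refine ⟨fun x hx => ⟨hx.1, hx.2.trans hlt⟩, fun h => ?_⟩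
      exact lt_irrefl A (h ⟨hA.1, hlt⟩ : IsStringEigenvalue L ρ A ∧ A < A).2
    have hcard := hfin.encard_lt_encard hss
    have h3 := hA.2.trans hB.2.symm
    have h4 := ENat.add_left_injective_of_ne_top ENat.one_ne_top h3
    exact hcard.ne h4
  exact le_antisymm (not_lt.mp (key hF hE)) (not_lt.mp (key hE hF))

/-- The `n`-th eigenvalue `E_n` of the string, as a number: the unique `E` which is the `n`-th
eigenvalue. (If there is none the value is meaningless, namely `0`.) -/
def stringEigenvalue (L : ℝ) (ρ : ℝ → ℝ) (n : ℕ) : ℝ :=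
  sInf {E : ℝ | IsNthStringEigenvalue L ρ n E}

theorem IsNthStringEigenvalue.eq_stringEigenvalue {L : ℝ} {ρ : ℝ → ℝ} {n : ℕ} {E : ℝ}
    (hE : IsNthStringEigenvalue L ρ n E) : stringEigenvalue L ρ n = E := by
  have h : {E' : ℝ | IsNthStringEigenvalue L ρ n E'} = {E} := by
    ext E'
    exact ⟨fun h => h.unique hE, fun h => by rw [Set.mem_singleton_iff.mp h]; exact hE⟩
  rw [stringEigenvalue, h, csInf_singleton]

/-- The rapidly oscillating density `ρ(x) = 2 + sin (2π(x + 1/2)/ε)`. -/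
def oscDensity (ε : ℝ) (x : ℝ) : ℝ :=
  2 + Real.sin (2 * Real.pi * (x + 1 / 2) / ε)

/-- `E_n(ε)`: the `n`-th eigenvalue of the string of density `oscDensity ε` on `[-1/2, 1/2]`. -/
def oscEigenvalue (n : ℕ) (ε : ℝ) : ℝ :=
  stringEigenvalue (1 / 2) (oscDensity ε) n

end

open Filter Topology Asymptotics

noncomputable section

/-! Put δ = ε / (2π) and shift the interval to [0, 1], so that the density is 2 + sin(t/δ). The
eigenvalues are the E for which the solution with y(0) = 0, y'(0) = 1 also vanishes at 1. The proof
finds the n-th one roughly and then compares it with an accurate approximate solution.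

Localisation. With E = κ²/2, one corrector of size δ² shows that the shooting solution is sin(κt)/κ
+ O(δ), uniformly for bounded κ (`exists_abs_shooting_sub_sin_le`). Hence y(1) changes sign near
each kπ with 1 ≤ k ≤ n, and every zero κ up to about nπ lies near one of these. Two zeros near the
same kπ give the same energy: eigenfunctions of different energies are ρ-orthogonal, whereas two
functions close to sin(kπt)/(kπ) have positive ρ-product. Energies E ≤ 0 are excluded by
monotonicity. This fixes the index n (`exists_isNthStringEigenvalue`).

Expansion. Let s = sin(t/δ), c = cos(t/δ) and u'' = -κ²u. The two-scale ansatz A(s) u + δ c Q(s) u',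
with A and Q polynomial in s and δκ, solves the equation up to O(δ⁶) at the energy `quasiEnergy`. It
vanishes at 0. To vanish at 1 up to O(δ⁶) its wave number must be moved off nπ by an amount
depending on the sine and cosine of 1/δ (`quasiShift`); this shift is the source of the oscillating
terms. Lagrange's identity between quasimode and true eigenfunction bounds the energy difference by
residual plus endpoint defect, divided by a ρ-product that stays away from 0 (`abs_energy_sub_le`).
Expanding `quasiEnergy` at the shifted wave number gives the order ε⁵ formula for every n; the other
expansions follow from it. -/

/-- The pair `f`, `g` solves `f' = g`, `g' = -E ρ f + r` on `[0, 1]`. -/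
structure IsForcedString (ρ : ℝ → ℝ) (E : ℝ) (r f g : ℝ → ℝ) : Prop where
  deriv_fst : ∀ t ∈ Set.Icc (0 : ℝ) 1, HasDerivWithinAt f (g t) (Set.Icc 0 1) t
  deriv_snd : ∀ t ∈ Set.Icc (0 : ℝ) 1,
    HasDerivWithinAt g (-(E * ρ t * f t) + r t) (Set.Icc 0 1) t

/-- The pair `y`, `v = y'` solves `y'' = -E ρ y` on `[0, 1]` with `y 0 = 0` and `y' 0 = 1`. -/
structure IsShooting (ρ : ℝ → ℝ) (E : ℝ) (y v : ℝ → ℝ) : Prop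
    extends IsForcedString ρ E (fun _ => 0) y v where
  fst_zero : y 0 = 0
  snd_zero : v 0 = 1

/-! ### Forced strings: Gronwall's estimate and Lagrange's identity -/

namespace IsForcedString

variable {ρ : ℝ → ℝ} {E : ℝ} {r f g : ℝ → ℝ}

theorem continuousOn_fst (h : IsForcedString ρ E r f g) : ContinuousOn f (Set.Icc 0 1) :=
  fun t ht => (h.deriv_fst t ht).continuousWithinAt

theorem continuousOn_snd (h : IsForcedString ρ E r f g) : ContinuousOn g (Set.Icc 0 1) :=
  fun t ht => (h.deriv_snd t ht).continuousWithinAt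

/-- Gronwall's estimate for a forced string. -/
theorem abs_le (h : IsForcedString ρ E r f g) {B M R D : ℝ}
    (hρ : ∀ t, |ρ t| ≤ B) (hE : |E| ≤ M) (hr : ∀ t ∈ Set.Icc (0 : ℝ) 1, |r t| ≤ R)
    (hf : f 0 = 0) (hg : |g 0| ≤ D) {t : ℝ} (ht : t ∈ Set.Icc (0 : ℝ) 1) :
    |f t| ≤ (D + R) * Real.exp (1 + M * B) ∧ |g t| ≤ (D + R) * Real.exp (1 + M * B) := by
  have hB : 0 ≤ B := (abs_nonneg _).trans (hρ 0)
  have hM : 0 ≤ M := (abs_nonneg _).trans hE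
  have hR : 0 ≤ R := (abs_nonneg _).trans (hr 0 (by simp))
  have hD : 0 ≤ D := (abs_nonneg _).trans hg
  have hMB : 0 ≤ M * B := mul_nonneg hM hB
  set K := 1 + M * B with hK
  have hK1 : 1 ≤ K := by linarith
  have key := norm_le_gronwallBound_of_norm_deriv_right_le (f := fun t => (f t, g t))
    (f' := fun t => (g t, -(E * ρ t * f t) + r t)) (δ := D) (K := K) (ε := R) (a := 0) (b := 1)
    (h.continuousOn_fst.prodMk h.continuousOn_snd)
    (fun x hx => by
      have hx' : x ∈ Set.Icc (0 : ℝ) 1 := ⟨hx.1, hx.2.le⟩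
      have hmem : Set.Icc (0 : ℝ) 1 ∈ 𝓝[Set.Ici x] x :=
        mem_of_superset (Icc_mem_nhdsGE hx.2) (Set.Icc_subset_Icc_left hx.1)
      exact ((h.deriv_fst x hx').prodMk (h.deriv_snd x hx')).mono_of_mem_nhdsWithin hmem)
    (by simp [hf, hg])
    (fun x hx => by
      have hx' : x ∈ Set.Icc (0 : ℝ) 1 := ⟨hx.1, hx.2.le⟩
      have hfn : |f x| ≤ ‖(f x, g x)‖ := by simp [Prod.norm_def]
      have hgn : |g x| ≤ ‖(f x, g x)‖ := by simp [Prod.norm_def]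
      have hn : 0 ≤ ‖(f x, g x)‖ := norm_nonneg _
      have h1 : |E * ρ x * f x| ≤ M * B * ‖(f x, g x)‖ := by
        rw [abs_mul, abs_mul]
        exact mul_le_mul (mul_le_mul hE (hρ x) (abs_nonneg _) hM) hfn (abs_nonneg _) hMB
      have h2 := hr x hx'
      rw [Prod.norm_def]
      refine max_le ?_ ?_
      · simp only [Real.norm_eq_abs]
        nlinarith
      · simp only [Real.norm_eq_abs]
        have h3 := abs_add_le (-(E * ρ x * f x)) (r x)
        rw [abs_neg] at h3
        nlinarith)
    t ht
  have hle : gronwallBound D K R (t - 0) ≤ (D + R) * Real.exp K := by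
    rw [gronwallBound_of_K_ne_0 (by linarith), sub_zero]
    have h1 : Real.exp (K * t) ≤ Real.exp K :=
      Real.exp_le_exp.mpr (by nlinarith [ht.2])
    have h2 : R / K ≤ R := div_le_self hR hK1
    have h3 : 1 ≤ Real.exp (K * t) := Real.one_le_exp (mul_nonneg (by linarith) ht.1)
    have h4 : R / K * (Real.exp (K * t) - 1) ≤ R * Real.exp K :=
      mul_le_mul h2 (by linarith) (by linarith) hR
    nlinarith
  have := key.trans hle
  rw [Prod.norm_def] at this
  exact ⟨(le_max_left _ _).trans this, (le_max_right _ _).trans this⟩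

/-- Lagrange's identity for a forced string and a free one. -/
theorem wronskian_eq (h : IsForcedString ρ E r f g) {F : ℝ} {y v : ℝ → ℝ}
    (hy : IsForcedString ρ F (fun _ => 0) y v) (hρ : Continuous ρ)
    (hr : ContinuousOn r (Set.Icc 0 1)) :
    (F - E) * (∫ t in (0 : ℝ)..1, ρ t * f t * y t) + ∫ t in (0 : ℝ)..1, r t * y t
      = (g 1 * y 1 - f 1 * v 1) - (g 0 * y 0 - f 0 * v 0) := by
  have hu : Set.uIcc (0 : ℝ) 1 = Set.Icc 0 1 := Set.uIcc_of_le zero_le_one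
  have c1 : ContinuousOn (fun t => ρ t * f t * y t) (Set.uIcc 0 1) := by
    rw [hu]
    exact (hρ.continuousOn.mul h.continuousOn_fst).mul hy.continuousOn_fst
  have c2 : ContinuousOn (fun t => r t * y t) (Set.uIcc 0 1) := by
    rw [hu]
    exact hr.mul hy.continuousOn_fst
  have key := intervalIntegral.integral_eq_sub_of_hasDerivAt_of_le zero_le_one
    (f := fun t => g t * y t - f t * v t)
    (f' := fun t => (F - E) * (ρ t * f t * y t) + r t * y t)
    ((h.continuousOn_snd.mul hy.continuousOn_fst).sub
      (h.continuousOn_fst.mul hy.continuousOn_snd))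
    (fun t ht => by
      have ht' : t ∈ Set.Icc (0 : ℝ) 1 := Set.Ioo_subset_Icc_self ht
      have hn : Set.Icc (0 : ℝ) 1 ∈ 𝓝 t := Icc_mem_nhds ht.1 ht.2
      have d1 := (h.deriv_fst t ht').hasDerivAt hn
      have d2 := (h.deriv_snd t ht').hasDerivAt hn
      have d3 := (hy.deriv_fst t ht').hasDerivAt hn
      have d4 := (hy.deriv_snd t ht').hasDerivAt hn
      refine ((d2.mul d3).sub (d1.mul d4)).congr_deriv ?_
      ring)
    ((c1.const_mul _).add c2).intervalIntegrable
  rw [← key, intervalIntegral.integral_add (c1.const_mul _).intervalIntegrable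
    c2.intervalIntegrable, intervalIntegral.integral_const_mul]

end IsForcedString

/-! ### The shooting function and its zeros -/

/-- The initial value problem for a string has a solution (by Prüfer's substitution). -/
theorem exists_isShooting {ρ : ℝ → ℝ} (hρ : Continuous ρ) {B : ℝ} (hB : ∀ t, |ρ t| ≤ B) (E : ℝ) :
    ∃ y v : ℝ → ℝ, IsShooting ρ E y v := by
  have hB0 : 0 ≤ B := (abs_nonneg _).trans (hB 0)
  set L : ℝ := 1 + |E| * B with hL
  have hL0 : 0 ≤ L := by positivity
  have hbd : ∀ t, |E * ρ t - 1| ≤ L := fun t => by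
    have h1 := abs_sub (E * ρ t) 1
    have h2 : |E * ρ t| ≤ |E| * B := by
      rw [abs_mul]; exact mul_le_mul_of_nonneg_left (hB t) (abs_nonneg _)
    rw [abs_one] at h1
    linarith
  -- Prüfer's angle obeys θ' = cos²θ + Eρ sin²θ. Unlike the linear system, this right-hand side is
  -- globally bounded (by 1 + L) and Lipschitz in θ (constant 2L), so one Picard–Lindelöf step of
  -- length 1 covers the whole interval.
  have hPL : IsPicardLindelof (fun t θ => 1 + (E * ρ t - 1) * Real.sin θ ^ 2)
      (tmin := 0) (tmax := 1) ⟨0, by simp⟩ (0 : ℝ) (1 + L).toNNReal 0 (1 + L).toNNReal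
      (2 * L).toNNReal := by
    refine ⟨fun t _ => ?_, fun x _ => ?_, fun t _ x _ => ?_, ?_⟩
    · refine LipschitzOnWith.of_dist_le_mul fun x _ z _ => ?_
      rw [Real.coe_toNNReal _ (by positivity), Real.dist_eq, Real.dist_eq]
      have e : 1 + (E * ρ t - 1) * Real.sin x ^ 2 - (1 + (E * ρ t - 1) * Real.sin z ^ 2)
          = (E * ρ t - 1) * (Real.sin x - Real.sin z) * (Real.sin x + Real.sin z) := by ring
      rw [e, abs_mul, abs_mul]
      have h1 := Real.abs_sin_sub_sin_le x z
      have h2 : |Real.sin x + Real.sin z| ≤ 2 := by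
        have := abs_add_le (Real.sin x) (Real.sin z)
        have := Real.abs_sin_le_one x
        have := Real.abs_sin_le_one z
        linarith
      calc _ ≤ L * |x - z| * 2 := by
            gcongr
            exact hbd t
        _ = _ := by ring
    · fun_prop
    · rw [Real.coe_toNNReal _ (by positivity), Real.norm_eq_abs]
      have h1 := abs_add_le 1 ((E * ρ t - 1) * Real.sin x ^ 2)
      rw [abs_one, abs_mul, abs_of_nonneg (sq_nonneg (Real.sin x))] at h1
      have h2 : |E * ρ t - 1| * Real.sin x ^ 2 ≤ L * 1 :=
        mul_le_mul (hbd t) (Real.sin_sq_le_one x) (sq_nonneg _) hL0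
      linarith
    · simp
  obtain ⟨θ, hθ0, hθ⟩ := hPL.exists_eq_forall_mem_Icc_hasDerivWithinAt₀
  have hθ0' : θ 0 = 0 := hθ0
  have hθc : ContinuousOn θ (Set.Icc 0 1) := fun t ht => (hθ t ht).continuousWithinAt
  -- Extending the angle continuously to the line makes the integrand for log q continuous
  -- everywhere, so the fundamental theorem of calculus also applies at the end points.
  set θ' : ℝ → ℝ := Set.IccExtend zero_le_one (Set.domRestrict (Set.Icc (0 : ℝ) 1) θ) with hθ'
  have hθ'c : Continuous θ' := hθc.domRestrict.Icc_extend'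
  have hθ'e : ∀ t ∈ Set.Icc (0 : ℝ) 1, θ' t = θ t := fun t ht => by
    rw [hθ', Set.IccExtend_of_mem zero_le_one _ ht, Set.domRestrict_apply]
  set I : ℝ → ℝ := fun t => (1 - E * ρ t) * (Real.sin (θ' t) * Real.cos (θ' t)) with hI
  have hIc : Continuous I := by fun_prop
  set q : ℝ → ℝ := fun t => Real.exp (∫ s in (0 : ℝ)..t, I s) with hq
  have hqd : ∀ t ∈ Set.Icc (0 : ℝ) 1, HasDerivWithinAt q
      (q t * ((1 - E * ρ t) * (Real.sin (θ t) * Real.cos (θ t)))) (Set.Icc 0 1) t :=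
    fun t ht => by
      have h1 := (hIc.integral_hasStrictDerivAt 0 t).hasDerivAt.exp.hasDerivWithinAt
        (s := Set.Icc (0 : ℝ) 1)
      rw [hI] at h1
      simp only [hθ'e t ht] at h1
      exact h1
  refine ⟨fun t => q t * Real.sin (θ t), fun t => q t * Real.cos (θ t), ⟨⟨fun t ht => ?_,
    fun t ht => ?_⟩, ?_, ?_⟩⟩
  · refine ((hqd t ht).mul (hθ t ht).sin).congr_deriv ?_
    ring
  · refine ((hqd t ht).mul (hθ t ht).cos).congr_deriv ?_
    linear_combination (q t * Real.sin (θ t) * (1 - E * ρ t)) * Real.sin_sq_add_cos_sq (θ t)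
  · simp [hθ0']
  · simp [hθ0', hq]

namespace IsShooting

variable {ρ : ℝ → ℝ} {E : ℝ} {y v : ℝ → ℝ}

theorem abs_le (h : IsShooting ρ E y v) {B M : ℝ} (hρ : ∀ t, |ρ t| ≤ B) (hE : |E| ≤ M) {t : ℝ}
    (ht : t ∈ Set.Icc (0 : ℝ) 1) :
    |y t| ≤ Real.exp (1 + M * B) ∧ |v t| ≤ Real.exp (1 + M * B) := by
  have := h.toIsForcedString.abs_le hρ hE (R := 0) (D := 1) (by simp) h.fst_zero
    (by simp [h.snd_zero]) ht
  simpa using this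

/-- The solution of the initial value problem is Lipschitz in `E`. -/
theorem abs_sub_le (h : IsShooting ρ E y v) {F : ℝ} {z w : ℝ → ℝ} (h' : IsShooting ρ F z w)
    {B M : ℝ} (hρ : ∀ t, |ρ t| ≤ B) (hE : |E| ≤ M) (hF : |F| ≤ M) {t : ℝ}
    (ht : t ∈ Set.Icc (0 : ℝ) 1) :
    |y t - z t| ≤ |E - F| * (B * Real.exp (1 + M * B) ^ 2) := by
  have hB : 0 ≤ B := (abs_nonneg _).trans (hρ 0)
  -- The difference of the two solutions has zero Cauchy data and is forced only by the change of
  -- energy, so Gronwall applies.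
  have hs : IsForcedString ρ E (fun t => (F - E) * ρ t * z t) (fun t => y t - z t)
      (fun t => v t - w t) := by
    refine ⟨fun s hs => (h.deriv_fst s hs).sub (h'.deriv_fst s hs), fun s hs => ?_⟩
    refine ((h.deriv_snd s hs).sub (h'.deriv_snd s hs)).congr_deriv ?_
    ring
  have := (hs.abs_le hρ hE (R := |E - F| * B * Real.exp (1 + M * B)) (D := 0)
    (fun s hs => by
      rw [abs_mul, abs_mul, abs_sub_comm F E]
      gcongr
      · exact hρ s
      · exact (h'.abs_le hρ hF hs).1)
    (by simp [h.fst_zero, h'.fst_zero]) (by simp [h.snd_zero, h'.snd_zero]) ht).1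
  calc _ ≤ _ := this
    _ = _ := by ring

theorem not_forall_eq_zero (h : IsShooting ρ E y v) : ¬ ∀ t ∈ Set.Icc (0 : ℝ) 1, y t = 0 := by
  intro h0
  have h1 := h.deriv_fst 0 (by simp)
  have h2 : HasDerivWithinAt y 0 (Set.Icc (0 : ℝ) 1) 0 :=
    (hasDerivWithinAt_const (0 : ℝ) (Set.Icc (0 : ℝ) 1) (0 : ℝ)).congr h0 (h0 0 (by simp))
  have h3 := (uniqueDiffOn_Icc (zero_lt_one (α := ℝ)) 0 (by simp)).eq_deriv _ h1 h2
  rw [h.snd_zero] at h3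
  exact one_ne_zero h3

/-- For E ≤ 0, (y v)' = v² - E ρ y² ≥ 0, so y v ≥ 0 and y² is nondecreasing. A zero at 1 would then
force y to vanish identically. -/
theorem apply_one_ne_zero_of_nonpos (h : IsShooting ρ E y v) (hρ : ∀ t, 0 ≤ ρ t) (hE : E ≤ 0) :
    y 1 ≠ 0 := by
  intro h1
  have hint : interior (Set.Icc (0 : ℝ) 1) = Set.Ioo 0 1 := interior_Icc
  have hmono : MonotoneOn (fun t => y t * v t) (Set.Icc 0 1) := by
    refine monotoneOn_of_hasDerivWithinAt_nonneg (convex_Icc 0 1)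
      (h.continuousOn_fst.mul h.continuousOn_snd)
      (fun t ht => ((h.deriv_fst t (interior_subset ht)).mul
        (h.deriv_snd t (interior_subset ht))).mono interior_subset) (fun t _ => ?_)
    have := mul_nonneg (mul_nonneg (neg_nonneg.mpr hE) (hρ t)) (sq_nonneg (y t))
    nlinarith [sq_nonneg (v t)]
  have hmono2 : MonotoneOn (fun t => y t * y t) (Set.Icc 0 1) := by
    refine monotoneOn_of_hasDerivWithinAt_nonneg (convex_Icc 0 1)
      (h.continuousOn_fst.mul h.continuousOn_fst)
      (fun t ht => ((h.deriv_fst t (interior_subset ht)).mul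
        (h.deriv_fst t (interior_subset ht))).mono interior_subset) (fun t ht => ?_)
    have ht' := interior_subset ht
    have := hmono (by simp) ht' ht'.1
    simp only [h.fst_zero, zero_mul] at this
    linarith
  refine h.not_forall_eq_zero fun t ht => ?_
  have := hmono2 ht (by simp) ht.2
  simp only [h1, mul_zero] at this
  nlinarith [mul_self_nonneg (y t), mul_self_eq_zero.mp (le_antisymm this (mul_self_nonneg (y t)))]

/-- The eigenvalues of the string on `[-1/2, 1/2]` are the zeros of the shooting function. -/
theorem isStringEigenvalue_iff (h : IsShooting ρ E y v) {B : ℝ} (hρ : ∀ t, |ρ t| ≤ B) :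
    IsStringEigenvalue (1 / 2) (fun x => ρ (x + 1 / 2)) E ↔ y 1 = 0 := by
  constructor
  · rintro ⟨ψ, φ, hψ, hφ, h0, h1, x, hx, hne⟩
    have hmaps : Set.MapsTo (fun t : ℝ => t - 1 / 2) (Set.Icc 0 1) (Set.Icc (-(1 / 2)) (1 / 2)) :=
      fun t ht => ⟨by linarith [ht.1], by linarith [ht.2]⟩
    have hsh : ∀ t : ℝ, HasDerivWithinAt (fun t : ℝ => t - 1 / 2) 1 (Set.Icc 0 1) t := fun t =>
      (hasDerivWithinAt_id t _).sub_const _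
    set c := φ (-(1 / 2)) with hc
    -- Subtracting c y from the shifted eigenfunction leaves zero Cauchy data and no forcing, so
    -- Gronwall gives ψ = c y; here c ≠ 0 because ψ is not identically zero.
    have hs : IsForcedString ρ E (fun _ => 0) (fun t => ψ (t - 1 / 2) - c * y t)
        (fun t => φ (t - 1 / 2) - c * v t) := by
      refine ⟨fun t ht => ?_, fun t ht => ?_⟩
      · have := (hψ _ (hmaps ht)).scomp t (hsh t) hmaps
        refine (this.sub ((h.deriv_fst t ht).const_mul c)).congr_deriv ?_
        simp
      · have := (hφ _ (hmaps ht)).scomp t (hsh t) hmaps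
        refine (this.sub ((h.deriv_snd t ht).const_mul c)).congr_deriv ?_
        simp
        ring
    have hz : ∀ t ∈ Set.Icc (0 : ℝ) 1, ψ (t - 1 / 2) = c * y t := fun t ht => by
      have := (hs.abs_le hρ le_rfl (R := 0) (D := 0) (by simp)
        (by simp [h.fst_zero]; simpa using h0) (by simp [h.snd_zero, hc]) ht).1
      simpa [sub_eq_zero] using this
    have h2 := hz 1 (by simp)
    have h3 := hz (x + 1 / 2) ⟨by linarith [hx.1], by linarith [hx.2]⟩
    rw [show (1 : ℝ) - 1 / 2 = 1 / 2 by norm_num, h1] at h2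
    rw [add_sub_cancel_right] at h3
    rcases mul_eq_zero.mp h2.symm with h4 | h4
    · rw [h4, zero_mul] at h3
      exact absurd h3 hne
    · exact h4
  · intro h1
    have hmaps : Set.MapsTo (fun x : ℝ => x + 1 / 2) (Set.Icc (-(1 / 2)) (1 / 2)) (Set.Icc 0 1) :=
      fun t ht => ⟨by linarith [ht.1], by linarith [ht.2]⟩
    have hsh : ∀ x : ℝ, HasDerivWithinAt (fun x : ℝ => x + 1 / 2) 1
        (Set.Icc (-(1 / 2)) (1 / 2)) x := fun x => (hasDerivWithinAt_id x _).add_const _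
    refine ⟨fun x => y (x + 1 / 2), fun x => v (x + 1 / 2), fun x hx => ?_, fun x hx => ?_, ?_, ?_,
      ?_⟩
    · refine ((h.deriv_fst _ (hmaps hx)).scomp x (hsh x) hmaps).congr_deriv ?_
      simp
    · refine ((h.deriv_snd _ (hmaps hx)).scomp x (hsh x) hmaps).congr_deriv ?_
      simp
    · simp [h.fst_zero]
    · norm_num [h1]
    · by_contra! hcon
      refine h.not_forall_eq_zero fun t ht => ?_
      have := hcon (t - 1 / 2) ⟨by linarith [ht.1], by linarith [ht.2]⟩
      rwa [sub_add_cancel] at this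

end IsShooting

/-! ### The oscillating density and its homogenised limit -/

/-- The density `2 + sin (t / δ)` on `[0, 1]`. -/
def sinDensity (δ t : ℝ) : ℝ := 2 + Real.sin (t / δ)

theorem continuous_sinDensity (δ : ℝ) : Continuous (sinDensity δ) := by
  unfold sinDensity
  fun_prop

theorem one_le_sinDensity (δ t : ℝ) : 1 ≤ sinDensity δ t := by
  have := Real.neg_one_le_sin (t / δ)
  unfold sinDensity
  linarith

theorem sinDensity_le (δ t : ℝ) : sinDensity δ t ≤ 3 := by
  have := Real.sin_le_one (t / δ)
  unfold sinDensity
  linarith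

theorem abs_sinDensity_le (δ t : ℝ) : |sinDensity δ t| ≤ 3 :=
  abs_le.mpr ⟨by linarith [one_le_sinDensity δ t], sinDensity_le δ t⟩

theorem abs_sin_mul_div_le {κ t : ℝ} (hκ : 0 < κ) (ht : t ∈ Set.Icc (0 : ℝ) 1) :
    |Real.sin (κ * t) / κ| ≤ 1 := by
  rw [abs_div, abs_of_pos hκ, div_le_one hκ]
  have h1 := Real.abs_sin_le_abs (x := κ * t)
  rw [abs_of_nonneg (mul_nonneg hκ.le ht.1)] at h1
  nlinarith [ht.2]

/-- Used to replace a nearby wave number κ by the fixed multiple N of π, so that all comparisons are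
made with one reference function. The change is split between argument and prefactor. -/
theorem abs_sin_mul_div_sub_le {κ N t : ℝ} (hκ : 1 ≤ κ) (hN : 1 ≤ N)
    (ht : t ∈ Set.Icc (0 : ℝ) 1) :
    |Real.sin (κ * t) / κ - Real.sin (N * t) / N| ≤ 2 * |κ - N| := by
  have h0 : 0 < κ := by linarith
  have h0' : 0 < N := by linarith
  have e : Real.sin (κ * t) / κ - Real.sin (N * t) / N
      = (Real.sin (κ * t) - Real.sin (N * t)) / κ + (N - κ) / κ * (Real.sin (N * t) / N) := by
    field_simp
    ring
  have h1 : |Real.sin (κ * t) - Real.sin (N * t)| ≤ |κ - N| := by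
    refine (Real.abs_sin_sub_sin_le _ _).trans ?_
    rw [← sub_mul, abs_mul, abs_of_nonneg ht.1]
    exact mul_le_of_le_one_right (abs_nonneg _) ht.2
  have h2 : |(Real.sin (κ * t) - Real.sin (N * t)) / κ| ≤ |κ - N| := by
    rw [abs_div, abs_of_pos h0]
    exact (div_le_self (abs_nonneg _) hκ).trans h1
  have h3 : |(N - κ) / κ * (Real.sin (N * t) / N)| ≤ |κ - N| := by
    rw [abs_mul, abs_div, abs_of_pos h0, abs_sub_comm]
    exact (mul_le_of_le_one_right (by positivity) (abs_sin_mul_div_le h0' ht)).trans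
      (div_le_self (abs_nonneg _) hκ)
  rw [e]
  exact (abs_add_le _ _).trans (by linarith)

theorem integral_sin_mul_div_sq {N : ℝ} (hN : 0 < N) (hs : Real.sin N = 0) :
    ∫ t in (0 : ℝ)..1, (Real.sin (N * t) / N) ^ 2 = 1 / (2 * N ^ 2) := by
  have key := intervalIntegral.integral_eq_sub_of_hasDerivAt (a := 0) (b := 1)
    (f := fun t => (t - Real.sin (N * t) * Real.cos (N * t) / N) / (2 * N ^ 2))
    (f' := fun t => (Real.sin (N * t) / N) ^ 2)
    (fun t _ => by
      have h1 : HasDerivAt (fun t : ℝ => N * t) N t := by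
        simpa using (hasDerivAt_id t).const_mul N
      refine (((hasDerivAt_id t).sub ((h1.sin.mul h1.cos).div_const N)).div_const
        (2 * N ^ 2)).congr_deriv ?_
      field_simp
      linear_combination (-1) * Real.sin_sq_add_cos_sq (N * t))
    (Continuous.intervalIntegrable (by fun_prop) _ _)
  rw [key]
  simp [hs]

/-- A weighted scalar product of two functions close to `sin (N t) / N` is positive. -/
theorem le_integral_mul_of_close {ρ f g : ℝ → ℝ} {N σ : ℝ} (hρ : Continuous ρ)
    (h1 : ∀ t, 1 ≤ ρ t) (h3 : ∀ t, ρ t ≤ 3) (hN : 1 ≤ N) (hs : Real.sin N = 0)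
    (hf : ContinuousOn f (Set.Icc 0 1)) (hg : ContinuousOn g (Set.Icc 0 1)) (hσ : σ ≤ 1)
    (hfσ : ∀ t ∈ Set.Icc (0 : ℝ) 1, |f t - Real.sin (N * t) / N| ≤ σ)
    (hgσ : ∀ t ∈ Set.Icc (0 : ℝ) 1, |g t - Real.sin (N * t) / N| ≤ σ) :
    1 / (2 * N ^ 2) - 9 * σ ≤ ∫ t in (0 : ℝ)..1, ρ t * f t * g t := by
  have hu : Set.uIcc (0 : ℝ) 1 = Set.Icc 0 1 := Set.uIcc_of_le zero_le_one
  have hc : Continuous fun t => (Real.sin (N * t) / N) ^ 2 := by fun_prop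
  have e : ∫ t in (0 : ℝ)..1, ((Real.sin (N * t) / N) ^ 2 - 9 * σ) = 1 / (2 * N ^ 2) - 9 * σ := by
    rw [intervalIntegral.integral_sub (hc.intervalIntegrable _ _)
      (continuous_const.intervalIntegrable _ _), integral_sin_mul_div_sq (by linarith) hs]
    simp
  rw [← e]
  refine intervalIntegral.integral_mono_on zero_le_one
    ((hc.sub continuous_const).intervalIntegrable _ _)
    (ContinuousOn.intervalIntegrable (by rw [hu]; exact (hρ.continuousOn.mul hf).mul hg))
    fun t ht => ?_
  have hS := abs_sin_mul_div_le (by linarith : 0 < N) ht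
  set S := Real.sin (N * t) / N
  have ef : ρ t * f t * g t
      = ρ t * S ^ 2 + ρ t * ((f t - S) * (g t - S) + S * (f t - S) + S * (g t - S)) := by ring
  have hσ0 : 0 ≤ σ := (abs_nonneg _).trans (hfσ t ht)
  have b1 : |(f t - S) * (g t - S)| ≤ σ * 1 := by
    rw [abs_mul]
    exact mul_le_mul (hfσ t ht) ((hgσ t ht).trans hσ) (abs_nonneg _) hσ0
  have b2 : |S * (f t - S)| ≤ 1 * σ := by
    rw [abs_mul]
    exact mul_le_mul hS (hfσ t ht) (abs_nonneg _) zero_le_one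
  have b3 : |S * (g t - S)| ≤ 1 * σ := by
    rw [abs_mul]
    exact mul_le_mul hS (hgσ t ht) (abs_nonneg _) zero_le_one
  -- Each of the three error terms is at most σ in size; the weight ρ ≤ 3 turns 3σ into the 9σ of
  -- the statement.
  have b4 : -(3 * σ) ≤ (f t - S) * (g t - S) + S * (f t - S) + S * (g t - S) := by
    linarith [neg_le_of_abs_le b1, neg_le_of_abs_le b2, neg_le_of_abs_le b3]
  rw [ef]
  nlinarith [h1 t, h3 t, sq_nonneg S]

/-- To first order the rapidly oscillating string behaves like the string of density `2`. -/
theorem exists_abs_shooting_sub_sin_le (K : ℝ) : ∃ C, 0 ≤ C ∧ ∀ δ κ : ℝ, 0 < δ → δ ≤ 1 → 0 < κ →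
    κ ≤ K → ∀ y v, IsShooting (sinDensity δ) (κ ^ 2 / 2) y v → ∀ t ∈ Set.Icc (0 : ℝ) 1,
    |y t - Real.sin (κ * t) / κ| ≤ C * δ := by
  set M := K ^ 2 / 2 with hM
  have hM0 : 0 ≤ M := by positivity
  refine ⟨(2 * M + 5 * M ^ 2) * Real.exp (1 + M * 3) + M, by positivity, ?_⟩
  intro δ κ hδ hδ1 hκ hκK y v hy t ht
  have hE0 : 0 ≤ κ ^ 2 / 2 := by positivity
  have hEM : κ ^ 2 / 2 ≤ M := by rw [hM]; gcongr
  obtain ⟨E, hE⟩ : ∃ E, E = κ ^ 2 / 2 := ⟨_, rfl⟩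
  rw [← hE] at hy hE0 hEM
  have hk2 : κ ^ 2 = 2 * E := by rw [hE]; ring
  have h1 : ∀ x : ℝ, HasDerivAt (fun x : ℝ => κ * x) κ x := fun x => by
    simpa using (hasDerivAt_id x).const_mul κ
  have h2 : ∀ x : ℝ, HasDerivAt (fun x : ℝ => x / δ) (1 / δ) x := fun x => by
    simpa using (hasDerivAt_id x).div_const δ
  -- With u = sin(κx)/κ, the corrector δ² E sin(x/δ) u has leading second derivative -E sin(x/δ) u,
  -- cancelling the oscillating part of E ρ u. What remains is O(δ).
  have hs : IsForcedString (sinDensity δ) E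
      (fun x => 2 * δ * E * Real.cos (x / δ) * Real.cos (κ * x)
        + δ ^ 2 * E * (E * sinDensity δ x - κ ^ 2) * Real.sin (x / δ) * (Real.sin (κ * x) / κ))
      (fun x => Real.sin (κ * x) / κ + δ ^ 2 * E * (Real.sin (x / δ) * (Real.sin (κ * x) / κ)) - y x)
      (fun x => Real.cos (κ * x) + δ * E * (Real.cos (x / δ) * (Real.sin (κ * x) / κ))
        + δ ^ 2 * E * (Real.sin (x / δ) * Real.cos (κ * x)) - v x) := by
    refine ⟨fun x hx => ?_, fun x hx => ?_⟩
    · refine ((((h1 x).sin.div_const κ).add (((h2 x).sin.mul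
        ((h1 x).sin.div_const κ)).const_mul (δ ^ 2 * E))).hasDerivWithinAt.sub
          (hy.deriv_fst x hx)).congr_deriv ?_
      field_simp
      ring
    · refine ((((h1 x).cos.add (((h2 x).cos.mul
        ((h1 x).sin.div_const κ)).const_mul (δ * E))).add (((h2 x).sin.mul
          (h1 x).cos).const_mul (δ ^ 2 * E))).hasDerivWithinAt.sub
          (hy.deriv_snd x hx)).congr_deriv ?_
      unfold sinDensity
      field_simp
      linear_combination (-Real.sin (κ * x)) * hk2
  have hb := (hs.abs_le (abs_sinDensity_le δ) (M := M) (R := δ * (2 * M + 5 * M ^ 2)) (D := 0)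
    (by rw [abs_of_nonneg hE0]; exact hEM)
    (fun x hx => by
      have hS := abs_sin_mul_div_le hκ hx
      have hq : |E * sinDensity δ x - κ ^ 2| ≤ 5 * M := by
        rw [hk2, abs_le]
        constructor <;> nlinarith [one_le_sinDensity δ x, sinDensity_le δ x]
      have t1 : |2 * δ * E * Real.cos (x / δ) * Real.cos (κ * x)| ≤ 2 * δ * M * 1 * 1 := by
        rw [abs_mul, abs_mul, abs_of_nonneg (by positivity : 0 ≤ 2 * δ * E)]
        gcongr
        · exact Real.abs_cos_le_one _
        · exact Real.abs_cos_le_one _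
      have t2 : |δ ^ 2 * E * (E * sinDensity δ x - κ ^ 2) * Real.sin (x / δ)
          * (Real.sin (κ * x) / κ)| ≤ δ * 1 * M * (5 * M) * 1 * 1 := by
        rw [abs_mul, abs_mul, abs_mul, abs_of_nonneg (by positivity : 0 ≤ δ ^ 2 * E), sq]
        gcongr
        exact Real.abs_sin_le_one _
      refine (abs_add_le _ _).trans ?_
      nlinarith)
    (by simp [hy.fst_zero]) (by simp [hy.snd_zero]) ht).1
  have hS := abs_sin_mul_div_le hκ ht
  have hc : |δ ^ 2 * E * (Real.sin (t / δ) * (Real.sin (κ * t) / κ))| ≤ δ * 1 * M * (1 * 1) := by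
    rw [abs_mul, abs_of_nonneg (by positivity : 0 ≤ δ ^ 2 * E), abs_mul, sq]
    gcongr
    exact Real.abs_sin_le_one _
  rw [show y t - Real.sin (κ * t) / κ
      = δ ^ 2 * E * (Real.sin (t / δ) * (Real.sin (κ * t) / κ))
        - (Real.sin (κ * t) / κ + δ ^ 2 * E * (Real.sin (t / δ) * (Real.sin (κ * t) / κ)) - y t)
      by ring]
  refine (abs_sub _ _).trans ?_
  nlinarith

/-! ### Localising and counting the eigenvalues -/

/-- A criterion for being the `n`-th eigenvalue. -/
theorem isNthStringEigenvalue_of_forall {L : ℝ} {ρ : ℝ → ℝ} {n : ℕ} (hn : 1 ≤ n) {e : ℕ → ℝ}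
    (he : ∀ k, 1 ≤ k → k ≤ n → IsStringEigenvalue L ρ (e k))
    (hlt : ∀ k l, 1 ≤ k → k < l → l ≤ n → e k < e l)
    (hall : ∀ E, IsStringEigenvalue L ρ E → E < e n → ∃ k, 1 ≤ k ∧ k < n ∧ E = e k) :
    IsNthStringEigenvalue L ρ n (e n) := by
  refine ⟨he n hn le_rfl, ?_⟩
  have hset : {E' : ℝ | IsStringEigenvalue L ρ E' ∧ E' < e n}
      = e '' (Finset.Icc 1 (n - 1) : Finset ℕ) := by
    ext E
    simp only [Set.mem_ofPred_eq, Set.mem_image, Finset.coe_Icc, Set.mem_Icc]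
    constructor
    · rintro ⟨h1, h2⟩
      obtain ⟨k, hk1, hk2, rfl⟩ := hall E h1 h2
      exact ⟨k, ⟨hk1, by omega⟩, rfl⟩
    · rintro ⟨k, ⟨hk1, hk2⟩, rfl⟩
      exact ⟨he k hk1 (by omega), hlt k n hk1 (by omega) le_rfl⟩
  have hinj : Set.InjOn e (Finset.Icc 1 (n - 1) : Finset ℕ) := by
    intro k hk l hl h
    simp only [Finset.coe_Icc, Set.mem_Icc] at hk hl
    rcases lt_trichotomy k l with h1 | h1 | h1
    · exact absurd h (hlt k l hk.1 h1 (by omega)).ne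
    · exact h1
    · exact absurd h.symm (hlt l k hl.1 h1 (by omega)).ne
  rw [hset, hinj.encard_image, Set.encard_coe_eq_coe_finsetCard, Nat.card_Icc]
  norm_cast
  omega

/-- The zeros of the shooting function near `k π` are unique. -/
theorem shooting_zero_unique {ρ : ℝ → ℝ} (hρ : Continuous ρ) (h1 : ∀ t, 1 ≤ ρ t)
    (h3 : ∀ t, ρ t ≤ 3) {N σ E F : ℝ} (hN : 1 ≤ N) (hs : Real.sin N = 0) (hσ : σ ≤ 1)
    (hσN : 9 * σ < 1 / (2 * N ^ 2)) {y v z w : ℝ → ℝ} (hy : IsShooting ρ E y v)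
    (hz : IsShooting ρ F z w) (hy1 : y 1 = 0) (hz1 : z 1 = 0)
    (hyσ : ∀ t ∈ Set.Icc (0 : ℝ) 1, |y t - Real.sin (N * t) / N| ≤ σ)
    (hzσ : ∀ t ∈ Set.Icc (0 : ℝ) 1, |z t - Real.sin (N * t) / N| ≤ σ) : E = F := by
  have key := hy.toIsForcedString.wronskian_eq hz.toIsForcedString hρ continuousOn_const
  have hpos := le_integral_mul_of_close hρ h1 h3 hN hs hy.continuousOn_fst hz.continuousOn_fst hσ
    hyσ hzσ
  simp only [hy1, hz1, hy.fst_zero, hz.fst_zero, zero_mul, mul_zero, sub_zero,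
    intervalIntegral.integral_zero, add_zero] at key
  rcases mul_eq_zero.mp key with h | h
  · linarith
  · rw [h] at hpos
    linarith

theorem sin_nat_mul_pi_add (k : ℕ) (x : ℝ) :
    Real.sin (k * Real.pi + x) = (-1) ^ k * Real.sin x := by
  rw [add_comm, Real.sin_add_nat_mul_pi]

theorem cos_nat_mul_pi_add (k : ℕ) (x : ℝ) :
    Real.cos (k * Real.pi + x) = (-1) ^ k * Real.cos x := by
  rw [add_comm, Real.cos_add_nat_mul_pi]

/-- If `sin κ` is small compared to `κ`, then `κ` is close to a positive multiple of `π`. -/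
theorem exists_nat_abs_sub_le_of_abs_sin_le {κ s : ℝ} {n : ℕ} (hκ : 0 < κ)
    (hκn : κ < n * Real.pi + Real.pi / 2) (hs : |Real.sin κ / κ| ≤ s) (hs2 : s < 1 / 2) :
    ∃ k : ℕ, 1 ≤ k ∧ k ≤ n ∧ |κ - k * Real.pi| ≤ 2 * κ * s := by
  have hpi := Real.pi_pos
  -- The integer nearest to κ/π, so that κ - kπ lies in [-π/2, π/2], where Jordan's inequality
  -- applies.
  set k := ⌊κ / Real.pi + 1 / 2⌋₊ with hk
  have hk0 : 0 ≤ κ / Real.pi + 1 / 2 := by positivity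
  have hle := Nat.floor_le hk0
  have hlt := Nat.lt_floor_add_one (κ / Real.pi + 1 / 2)
  rw [← hk] at hle hlt
  have e : κ / Real.pi * Real.pi = κ := div_mul_cancel₀ _ hpi.ne'
  have hle' : k * Real.pi ≤ κ + Real.pi / 2 := by nlinarith
  have hlt' : κ - Real.pi / 2 < k * Real.pi := by nlinarith
  have hab : |κ - k * Real.pi| ≤ Real.pi / 2 := abs_le.mpr ⟨by linarith, by linarith⟩
  have hJ := Real.mul_abs_le_abs_sin hab
  have hsin : |Real.sin κ| = |Real.sin (κ - k * Real.pi)| := by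
    conv_lhs => rw [show κ = k * Real.pi + (κ - k * Real.pi) by ring, sin_nat_mul_pi_add]
    simp [abs_mul]
  rw [← hsin] at hJ
  rw [abs_div, abs_of_pos hκ, div_le_iff₀ hκ] at hs
  have h2pi : 1 / 2 ≤ 2 / Real.pi := by
    rw [div_le_div_iff₀ (by norm_num) hpi]
    linarith [Real.pi_le_four]
  have hfin : |κ - k * Real.pi| ≤ 2 * κ * s := by
    nlinarith [abs_nonneg (κ - k * Real.pi)]
  refine ⟨k, ?_, ?_, hfin⟩
  · by_contra hcon
    have hk' : k = 0 := by omega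
    rw [hk', Nat.cast_zero, zero_mul, sub_zero, abs_of_pos hκ] at hfin
    nlinarith
  · by_contra hcon
    have h1 : (n : ℝ) + 1 ≤ k := by exact_mod_cast (by omega : n + 1 ≤ k)
    nlinarith

theorem one_le_nat_mul_pi {k : ℕ} (hk : 1 ≤ k) : 1 ≤ (k : ℝ) * Real.pi := by
  have : (1 : ℝ) ≤ k := by exact_mod_cast hk
  nlinarith [Real.pi_gt_three]

/-- For small `δ` the `n`-th eigenvalue exists and is close to `(n π) ^ 2 / 2`. -/
theorem exists_isNthStringEigenvalue {n : ℕ} (hn : 1 ≤ n) {η : ℝ} (hη : 0 < η) :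
    ∃ δ₀, 0 < δ₀ ∧ ∀ δ, 0 < δ → δ < δ₀ → ∃ κ, |κ - n * Real.pi| ≤ η ∧
      IsNthStringEigenvalue (1 / 2) (fun x => sinDensity δ (x + 1 / 2)) n (κ ^ 2 / 2) := by
  have hpi := Real.pi_gt_three
  have hn1 : (1 : ℝ) ≤ n := by exact_mod_cast hn
  set Nn : ℝ := n * Real.pi with hNn
  have hNn1 : 1 ≤ Nn := one_le_nat_mul_pi hn
  set K : ℝ := Nn + 1 with hK
  have hK0 : 0 < K := by linarith
  set q : ℝ := 1 / (2 * Nn ^ 2) with hq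
  have hq0 : 0 < q := by positivity
  have hq1 : q ≤ 1 / 2 := by
    rw [hq, div_le_div_iff₀ (by positivity) (by norm_num)]
    nlinarith
  -- Uniqueness will be applied with σ = τ₀ + 2η'. Bounding both by q/36 gives 9σ ≤ 3q/4 < q, where
  -- q is the smallest of the numbers 1/(2(kπ)²), k ≤ n. The further bound on 2Kτ₀ secures the sign
  -- change and keeps every zero within η' of some kπ.
  obtain ⟨η', hη'0, hη'η, hη'q⟩ : ∃ η', 0 < η' ∧ η' ≤ η ∧ η' ≤ q / 36 :=
    ⟨min η (q / 36), lt_min hη (by positivity), min_le_left _ _, min_le_right _ _⟩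
  obtain ⟨C, hC0, hC⟩ := exists_abs_shooting_sub_sin_le K
  -- smallness of `τ = C δ`
  obtain ⟨τ₀, hτ₀, hτq, hτη⟩ : ∃ τ₀, 0 < τ₀ ∧ τ₀ ≤ q / 36 ∧ 2 * K * τ₀ ≤ η' / 2 := by
    refine ⟨min (q / 36) (η' / (4 * K)), lt_min (by positivity) (by positivity), min_le_left _ _, ?_⟩
    calc 2 * K * min (q / 36) (η' / (4 * K)) ≤ 2 * K * (η' / (4 * K)) := by
          gcongr
          exact min_le_right _ _
      _ = η' / 2 := by
          field_simp
          norm_num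
  refine ⟨min 1 (τ₀ / (C + 1)), lt_min one_pos (by positivity), fun δ hδ hδ₀ => ?_⟩
  have hδ1 : δ ≤ 1 := hδ₀.le.trans (min_le_left _ _)
  have hCδ : C * δ ≤ τ₀ := by
    have h1 : δ ≤ τ₀ / (C + 1) := hδ₀.le.trans (min_le_right _ _)
    rw [le_div_iff₀ (by positivity)] at h1
    nlinarith
  choose Y V hYV using fun E => exists_isShooting (continuous_sinDensity δ) (abs_sinDensity_le δ) E
  have hev : ∀ E, IsStringEigenvalue (1 / 2) (fun x => sinDensity δ (x + 1 / 2)) E ↔ Y E 1 = 0 :=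
    fun E => (hYV E).isStringEigenvalue_iff (abs_sinDensity_le δ)
  have happ : ∀ κ, 0 < κ → κ ≤ K → ∀ t ∈ Set.Icc (0 : ℝ) 1,
      |Y (κ ^ 2 / 2) t - Real.sin (κ * t) / κ| ≤ τ₀ := fun κ h0 hκK t ht =>
    (hC δ κ hδ hδ1 h0 hκK _ _ (hYV _) t ht).trans hCδ
  have hkle : ∀ k : ℕ, k ≤ n → k * Real.pi ≤ Nn := fun k hk => by
    have : (k : ℝ) ≤ n := by exact_mod_cast hk
    rw [hNn]; gcongr
  have hη'1 : η' ≤ 1 / 72 := by linarith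
  -- uniqueness near each multiple of `π`
  have huniq : ∀ k : ℕ, 1 ≤ k → k ≤ n → ∀ κ κ', |κ - k * Real.pi| ≤ η' →
      |κ' - k * Real.pi| ≤ η' → Y (κ ^ 2 / 2) 1 = 0 → Y (κ' ^ 2 / 2) 1 = 0 →
      κ ^ 2 / 2 = κ' ^ 2 / 2 := by
    intro k hk1 hkn κ κ' hκ hκ' h0 h0'
    have hk3 : 3 ≤ k * Real.pi := by
      have : (1 : ℝ) ≤ k := by exact_mod_cast hk1
      nlinarith
    have hclose : ∀ κ, |κ - k * Real.pi| ≤ η' → ∀ t ∈ Set.Icc (0 : ℝ) 1,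
        |Y (κ ^ 2 / 2) t - Real.sin (k * Real.pi * t) / (k * Real.pi)| ≤ τ₀ + 2 * η' := by
      intro κ hκ t ht
      have h1 := abs_le.mp hκ
      have h2 := hkle k hkn
      have h3 := happ κ (by linarith) (by linarith) t ht
      have h4 := abs_sin_mul_div_sub_le (by linarith : 1 ≤ κ) (one_le_nat_mul_pi hk1) ht
      have h5 := abs_sub_le (Y (κ ^ 2 / 2) t) (Real.sin (κ * t) / κ)
        (Real.sin (k * Real.pi * t) / (k * Real.pi))
      linarith
    refine shooting_zero_unique (continuous_sinDensity δ) (one_le_sinDensity δ) (sinDensity_le δ)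
      (one_le_nat_mul_pi hk1) (Real.sin_nat_mul_pi k) (σ := τ₀ + 2 * η') (by linarith) ?_
      (hYV _) (hYV _) h0 h0' (hclose κ hκ) (hclose κ' hκ')
    have : q ≤ 1 / (2 * (k * Real.pi) ^ 2) := by
      rw [hq]
      gcongr
      exact hkle k hkn
    linarith
  -- existence near each multiple of `π`
  have hexist : ∀ k : ℕ, ∃ κ, 1 ≤ k → k ≤ n → |κ - k * Real.pi| ≤ η' ∧ Y (κ ^ 2 / 2) 1 = 0 := by
    intro k
    -- Outside 1 ≤ k ≤ n an arbitrary value is returned, so that `choose` yields a function of k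
    -- alone.
    by_cases hk : 1 ≤ k ∧ k ≤ n
    swap
    · exact ⟨0, fun h1 h2 => absurd ⟨h1, h2⟩ hk⟩
    obtain ⟨hk1, hkn⟩ := hk
    have hk3 : 3 ≤ k * Real.pi := by
      have : (1 : ℝ) ≤ k := by exact_mod_cast hk1
      nlinarith
    have h2 := hkle k hkn
    have hcont : ContinuousOn (fun κ : ℝ => (-1) ^ k * Y (κ ^ 2 / 2) 1)
        (Set.Icc (k * Real.pi - η') (k * Real.pi + η')) := by
      refine continuousOn_const.mul ?_
      have hbd : ∀ κ ∈ Set.Icc (k * Real.pi - η') (k * Real.pi + η'), |κ ^ 2 / 2| ≤ K ^ 2 / 2 := by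
        intro κ hκ
        rw [abs_of_nonneg (by positivity)]
        have : 0 ≤ κ := by linarith [hκ.1]
        have : κ ≤ K := by linarith [hκ.2]
        gcongr
      intro κ hκ
      rw [ContinuousWithinAt, tendsto_iff_dist_tendsto_zero]
      refine squeeze_zero' (Eventually.of_forall fun _ => dist_nonneg)
        (g := fun κ' => |κ' ^ 2 / 2 - κ ^ 2 / 2| * (3 * Real.exp (1 + K ^ 2 / 2 * 3) ^ 2)) ?_ ?_
      · filter_upwards [self_mem_nhdsWithin] with κ' hκ'
        rw [Real.dist_eq]
        exact (hYV _).abs_sub_le (hYV _) (abs_sinDensity_le δ) (hbd κ' hκ') (hbd κ hκ) (by simp)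
      · have : Continuous fun κ' : ℝ =>
            |κ' ^ 2 / 2 - κ ^ 2 / 2| * (3 * Real.exp (1 + K ^ 2 / 2 * 3) ^ 2) := by fun_prop
        simpa using (this.tendsto κ).mono_left nhdsWithin_le_nhds
    have hsin : η' / 2 ≤ Real.sin η' := by
      have h := Real.mul_le_sin hη'0.le (by linarith)
      have h2pi : 1 / 2 ≤ 2 / Real.pi := by
        rw [div_le_div_iff₀ (by norm_num) (by linarith)]
        linarith [Real.pi_le_four]
      nlinarith
    have hsign : ∀ κ, |κ - k * Real.pi| ≤ η' →
        |(-1) ^ k * Y (κ ^ 2 / 2) 1 - Real.sin (κ - k * Real.pi) / κ| ≤ τ₀ := by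
      intro κ hκ
      have h1 := abs_le.mp hκ
      have h3 := happ κ (by linarith) (by linarith) 1 (by simp)
      have e : Real.sin (κ - k * Real.pi) = (-1) ^ k * Real.sin κ := by
        conv_rhs => rw [show κ = k * Real.pi + (κ - k * Real.pi) by ring, sin_nat_mul_pi_add]
        rw [← mul_assoc, ← mul_pow]
        simp
      rw [e, mul_div_assoc, ← mul_sub, abs_mul, abs_pow, abs_neg, abs_one, one_pow, one_mul]
      simpa using h3
    -- At kπ ± η' the main term ± sin η' / κ outweighs the error τ₀, so the shooting function has
    -- opposite signs there.
    have hquot : ∀ κ, 0 < κ → κ ≤ K → τ₀ ≤ Real.sin η' / κ := by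
      intro κ h0 hκ
      rw [le_div_iff₀ h0]
      nlinarith
    have hlo := hsign (k * Real.pi - η') (by simp [abs_of_pos hη'0])
    have hhi := hsign (k * Real.pi + η') (by simp [abs_of_pos hη'0])
    rw [show k * Real.pi - η' - k * Real.pi = -η' by ring, Real.sin_neg, neg_div] at hlo
    rw [show k * Real.pi + η' - k * Real.pi = η' by ring] at hhi
    have q1 := hquot (k * Real.pi - η') (by linarith) (by linarith)
    have q2 := hquot (k * Real.pi + η') (by linarith) (by linarith)
    have := intermediate_value_Icc (by linarith : k * Real.pi - η' ≤ k * Real.pi + η') hcont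
      (show (0 : ℝ) ∈ _ from ⟨by linarith [(abs_le.mp hlo).2], by linarith [(abs_le.mp hhi).1]⟩)
    obtain ⟨κ, hκ, h0⟩ := this
    refine ⟨κ, fun _ _ => ⟨abs_le.mpr ⟨by linarith [hκ.1], by linarith [hκ.2]⟩, ?_⟩⟩
    simpa using h0
  choose κ hκ using hexist
  refine ⟨κ n, (hκ n hn le_rfl).1.trans hη'η, ?_⟩
  have hord : ∀ k l : ℕ, k < l → k * Real.pi + 1 ≤ l * Real.pi := fun k l hkl => by
    have : (k : ℝ) + 1 ≤ l := by exact_mod_cast hkl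
    nlinarith
  refine isNthStringEigenvalue_of_forall hn (e := fun k => κ k ^ 2 / 2)
    (fun k h1 h2 => (hev _).mpr (hκ k h1 h2).2) (fun k l h1 hkl h2 => ?_) (fun E hE hlt => ?_)
  · have hk := abs_le.mp (hκ k h1 (by omega)).1
    have hl := abs_le.mp (hκ l (by omega) h2).1
    have h3 := hord k l hkl
    have h4 := one_le_nat_mul_pi h1
    have : 0 ≤ κ k := by linarith
    have : κ k < κ l := by linarith
    gcongr
  · have hE0 := (hev E).mp hE
    have hEpos : 0 < E := by
      by_contra hcon
      exact (hYV E).apply_one_ne_zero_of_nonpos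
        (fun t => zero_le_one.trans (one_le_sinDensity δ t)) (not_lt.mp hcon) hE0
    -- Any smaller eigenvalue is positive, hence of the form μ²/2 with μ < κ n. It lies near some kπ
    -- with k ≤ n and equals the eigenvalue already found there; k = n is excluded by strictness.
    obtain ⟨μ, hμ0, rfl⟩ : ∃ μ, 0 < μ ∧ E = μ ^ 2 / 2 :=
      ⟨Real.sqrt (2 * E), by positivity, by rw [Real.sq_sqrt (by positivity)]; ring⟩
    have hnκ := abs_le.mp (hκ n hn le_rfl).1
    have hμn : μ < κ n := lt_of_pow_lt_pow_left₀ 2 (by linarith) (by linarith)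
    have hμK : μ ≤ K := by linarith
    have hsmall := happ μ hμ0 hμK 1 (by simp)
    rw [hE0, mul_one, zero_sub, abs_neg] at hsmall
    obtain ⟨k, hk1, hkn, hk⟩ := exists_nat_abs_sub_le_of_abs_sin_le (n := n) hμ0
      (by linarith) hsmall (by linarith)
    have hkη : |μ - k * Real.pi| ≤ η' := by
      refine hk.trans ?_
      have : 2 * μ * τ₀ ≤ 2 * K * τ₀ := by gcongr
      linarith
    have heq := huniq k hk1 hkn μ (κ k) hkη (hκ k hk1 hkn).1 hE0 (hκ k hk1 hkn).2
    refine ⟨k, hk1, lt_of_le_of_ne hkn ?_, heq⟩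
    rintro rfl
    exact hlt.ne heq

/-! ### The two-scale quasimode -/

/-- The equation solved by the ansatz `A (sin (t / δ)) u + δ cos (t / δ) Q (sin (t / δ)) u'`,
where `u'' = -κ ^ 2 u`. -/
theorem isForcedString_ansatz {A A₁ A₂ Q Q₁ Q₂ u w r : ℝ → ℝ} {δ κ E : ℝ} (hδ : δ ≠ 0)
    (hA : ∀ s, HasDerivAt A (A₁ s) s) (hA₁ : ∀ s, HasDerivAt A₁ (A₂ s) s)
    (hQ : ∀ s, HasDerivAt Q (Q₁ s) s) (hQ₁ : ∀ s, HasDerivAt Q₁ (Q₂ s) s)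
    (hu : ∀ t, HasDerivAt u (w t) t) (hw : ∀ t, HasDerivAt w (-(κ ^ 2 * u t)) t)
    (hr : ∀ t s c, s = Real.sin (t / δ) → c = Real.cos (t / δ) → s ^ 2 + c ^ 2 = 1 →
      r t = (-s * (A₁ s / δ ^ 2 - κ ^ 2 * Q s) + c ^ 2 * (A₂ s / δ ^ 2 - κ ^ 2 * Q₁ s)
          - κ ^ 2 * (A s - s * Q s + c ^ 2 * Q₁ s) + E * (2 + s) * A s) * u t
        + c * (A₁ s / δ - κ ^ 2 * δ * Q s + (A₁ s - Q s - 3 * s * Q₁ s + c ^ 2 * Q₂ s) / δ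
          + E * (2 + s) * δ * Q s) * w t) :
    IsForcedString (sinDensity δ) E r
      (fun t => A (Real.sin (t / δ)) * u t
        + δ * Real.cos (t / δ) * Q (Real.sin (t / δ)) * w t)
      (fun t => Real.cos (t / δ) * (A₁ (Real.sin (t / δ)) / δ
          - κ ^ 2 * δ * Q (Real.sin (t / δ))) * u t
        + (A (Real.sin (t / δ)) - Real.sin (t / δ) * Q (Real.sin (t / δ))
          + Real.cos (t / δ) ^ 2 * Q₁ (Real.sin (t / δ))) * w t) := by
  have hτ : ∀ t : ℝ, HasDerivAt (fun t : ℝ => t / δ) (1 / δ) t := fun t => by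
    simpa using (hasDerivAt_id t).div_const δ
  have hs := fun t => (hτ t).sin
  have hc := fun t => (hτ t).cos
  have dA := fun t => (hA (Real.sin (t / δ))).comp t (hs t)
  have dA₁ := fun t => (hA₁ (Real.sin (t / δ))).comp t (hs t)
  have dQ := fun t => (hQ (Real.sin (t / δ))).comp t (hs t)
  have dQ₁ := fun t => (hQ₁ (Real.sin (t / δ))).comp t (hs t)
  refine ⟨fun t _ => ?_, fun t _ => ?_⟩
  · refine (((dA t).mul (hu t)).add ((((hc t).const_mul δ).mul (dQ t)).mul
      (hw t))).hasDerivWithinAt.congr_deriv ?_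
    simp only [Function.comp_apply, Pi.mul_apply]
    field_simp
    ring
  · refine ((((hc t).mul (((dA₁ t).div_const δ).sub ((dQ t).const_mul (κ ^ 2 * δ)))).mul
      (hu t)).add ((((dA t).sub ((hs t).mul (dQ t))).add (((hc t).pow 2).mul (dQ₁ t))).mul
        (hw t))).hasDerivWithinAt.congr_deriv ?_
    rw [hr t _ _ rfl rfl (Real.sin_sq_add_cos_sq _)]
    simp only [Function.comp_apply, sinDensity, Pi.mul_apply, Pi.sub_apply, Pi.add_apply,
      Pi.pow_apply]
    field_simp
    ring

/-! ### The coefficients of the quasimode -/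

/-- With s = sin τ, the combinations below are harmonics: 1 - 2s² = cos 2τ, 3s - 4s³ = sin 3τ and
c(1 - 4s²) = cos 3τ. The corrections in A and c Q have mean zero in τ. Cancelling the residual order
by order in h = δκ determines them, and the mean of the u-equation determines the energy: at order
h⁴ the mean 1/8 of s²/4 is balanced by the coefficient 1/16 in `quasiEnergy`. -/
def quasiA₂ (s : ℝ) : ℝ := 31 / 16 * s - (1 - 2 * s ^ 2) / 32

def quasiA₃ (s : ℝ) : ℝ :=
  955 / 128 * s - 27 / 128 * (1 - 2 * s ^ 2) - (3 * s - 4 * s ^ 3) / 1152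

def quasiQ₂ (s : ℝ) : ℝ := 31 / 8 + 3 / 16 * s

def quasiQ₃ (s : ℝ) : ℝ := 1897 / 128 + 57 / 64 * s - 11 / 3456 * (1 - 4 * s ^ 2)

/-- This and `quasiRemQ` isolate what is left of A and Q after the powers h⁴ and h² are taken out,
so that later cancellations are exact polynomial identities. -/
def quasiRemA (h s : ℝ) : ℝ := quasiA₂ s + h ^ 2 * quasiA₃ s

def quasiRemQ (h s : ℝ) : ℝ := 1 + h ^ 2 * quasiQ₂ s + h ^ 4 * quasiQ₃ s

/-- Amplitude of `u` in the quasimode, as a function of `h = δ κ` and `s = sin (t / δ)`. -/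
def quasiA (h s : ℝ) : ℝ := 1 + h ^ 2 * (s / 2) + h ^ 4 * quasiRemA h s

/-- Amplitude of `δ cos (t / δ) u'` in the quasimode. -/
def quasiQ (h s : ℝ) : ℝ := h ^ 2 * quasiRemQ h s

/-- The energy of the quasimode of wave number `κ`. -/
def quasiEnergy (δ κ : ℝ) : ℝ :=
  κ ^ 2 * (1 / 2 - (δ * κ) ^ 2 / 16 - 15 / 64 * (δ * κ) ^ 4)

def quasiResU (h s : ℝ) : ℝ :=
  s / 2 * quasiA₃ s - (2 + s) / 16 * quasiA₂ s - 15 / 64 * (2 + s) * (s / 2)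
    + 2 * s * quasiQ₃ s - 2 * (1 - s ^ 2) * (57 / 64 + 11 / 432 * s)
    - h ^ 2 * (2 + s) * (quasiA₃ s / 16 + 15 / 64 * quasiA₂ s)
    - h ^ 4 * (15 / 64) * (2 + s) * quasiA₃ s

def quasiResW (h s : ℝ) : ℝ :=
  s / 2 * quasiQ₃ s - (2 + s) / 16 * quasiQ₂ s - 15 / 64 * (2 + s)
    - h ^ 2 * (2 + s) * (quasiQ₃ s / 16 + 15 / 64 * quasiQ₂ s)
    - h ^ 4 * (15 / 64) * (2 + s) * quasiQ₃ s

/-- The solution of u'' = -κ²u with u(0) = -δ Q(0) and u'(0) = A(0), chosen so that A(0) u(0) + δ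
Q(0) u'(0) = 0; `quasiW` is its derivative. -/
def quasiU (δ κ t : ℝ) : ℝ :=
  quasiA (δ * κ) 0 * (Real.sin (κ * t) / κ) - δ * quasiQ (δ * κ) 0 * Real.cos (κ * t)

def quasiW (δ κ t : ℝ) : ℝ :=
  quasiA (δ * κ) 0 * Real.cos (κ * t) + δ * κ * quasiQ (δ * κ) 0 * Real.sin (κ * t)

/-- A function which vanishes at `0` and solves the string equation up to `O(δ ^ 6)`. -/
def quasimode (δ κ t : ℝ) : ℝ :=
  quasiA (δ * κ) (Real.sin (t / δ)) * quasiU δ κ t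
    + δ * Real.cos (t / δ) * quasiQ (δ * κ) (Real.sin (t / δ)) * quasiW δ κ t

def quasiResidual (δ κ t : ℝ) : ℝ :=
  δ ^ 6 * κ ^ 8 * (quasiResU (δ * κ) (Real.sin (t / δ)) * quasiU δ κ t
    + δ * Real.cos (t / δ) * quasiResW (δ * κ) (Real.sin (t / δ)) * quasiW δ κ t)

theorem quasimode_zero (δ κ : ℝ) : quasimode δ κ 0 = 0 := by
  simp only [quasimode, quasiU, quasiW, zero_div, mul_zero, Real.sin_zero, Real.cos_zero]
  ring

/-- Once c² is replaced by 1 - s², the residual of the ansatz is a polynomial identity in which all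
orders below δ⁶ cancel. The derivative g can stay anonymous: in Lagrange's identity it is multiplied
only by the end values of the eigenfunction, which are zero. -/
theorem exists_isForcedString_quasimode {δ κ : ℝ} (hδ : δ ≠ 0) (hκ : κ ≠ 0) :
    ∃ g, IsForcedString (sinDensity δ) (quasiEnergy δ κ) (quasiResidual δ κ)
      (quasimode δ κ) g := by
  have h1 : ∀ x : ℝ, HasDerivAt (fun x : ℝ => κ * x) κ x := fun x => by
    simpa using (hasDerivAt_id x).const_mul κ
  refine ⟨_, isForcedString_ansatz (κ := κ) (A := quasiA (δ * κ)) (Q := quasiQ (δ * κ))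
    (A₁ := fun s => (δ * κ) ^ 2 / 2 + (δ * κ) ^ 4 * (31 / 16 + s / 8)
      + (δ * κ) ^ 6 * (955 / 128 + 27 / 32 * s - (3 - 12 * s ^ 2) / 1152))
    (A₂ := fun s => (δ * κ) ^ 4 / 8 + (δ * κ) ^ 6 * (27 / 32 + s / 48))
    (Q₁ := fun s => (δ * κ) ^ 4 * (3 / 16) + (δ * κ) ^ 6 * (57 / 64 + 11 / 432 * s))
    (Q₂ := fun s => (δ * κ) ^ 6 * (11 / 432))
    (u := quasiU δ κ) (w := quasiW δ κ) hδ ?_ ?_ ?_ ?_ ?_ ?_ ?_⟩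
  · intro s
    have i := hasDerivAt_id' s
    have p2 := hasDerivAt_pow 2 s
    have p3 := hasDerivAt_pow 3 s
    refine (((((i.div_const 2).const_mul ((δ * κ) ^ 2)).const_add 1).add
      ((((i.const_mul (31 / 16)).sub (((p2.const_mul 2).const_sub 1).div_const 32)).add
        ((((i.const_mul (955 / 128)).sub (((p2.const_mul 2).const_sub 1).const_mul (27 / 128))).sub
          (((i.const_mul 3).sub (p3.const_mul 4)).div_const 1152)).const_mul
            ((δ * κ) ^ 2))).const_mul ((δ * κ) ^ 4)))).congr_deriv ?_
    norm_num
    ring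
  · intro s
    have i := hasDerivAt_id' s
    have p2 := hasDerivAt_pow 2 s
    refine (((((i.div_const 8).const_add (31 / 16)).const_mul ((δ * κ) ^ 4)).const_add
      ((δ * κ) ^ 2 / 2)).add ((((i.const_mul (27 / 32)).const_add (955 / 128)).sub
        (((p2.const_mul 12).const_sub 3).div_const 1152)).const_mul ((δ * κ) ^ 6))).congr_deriv ?_
    norm_num
    ring
  · intro s
    have i := hasDerivAt_id' s
    have p2 := hasDerivAt_pow 2 s
    refine ((((((i.const_mul (3 / 16)).const_add (31 / 8)).const_mul ((δ * κ) ^ 2)).const_add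
      1).add ((((i.const_mul (57 / 64)).const_add (1897 / 128)).sub
        (((p2.const_mul 4).const_sub 1).const_mul (11 / 3456))).const_mul ((δ * κ) ^ 4))).const_mul
          ((δ * κ) ^ 2)).congr_deriv ?_
    norm_num
    ring
  · intro s
    have i := hasDerivAt_id' s
    refine ((((i.const_mul (11 / 432)).const_add (57 / 64)).const_mul ((δ * κ) ^ 6)).const_add
      ((δ * κ) ^ 4 * (3 / 16))).congr_deriv ?_
    ring
  · intro t
    refine ((((h1 t).sin.div_const κ).const_mul (quasiA (δ * κ) 0)).sub
      ((h1 t).cos.const_mul (δ * quasiQ (δ * κ) 0))).congr_deriv ?_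
    unfold quasiW
    field_simp
    ring
  · intro t
    refine (((h1 t).cos.const_mul (quasiA (δ * κ) 0)).add
      ((h1 t).sin.const_mul (δ * κ * quasiQ (δ * κ) 0))).congr_deriv ?_
    unfold quasiU
    field_simp
    ring
  · intro t s c hs hc hsc
    have hc2 : c ^ 2 = 1 - s ^ 2 := by linarith
    rw [quasiResidual, ← hs, ← hc, hc2]
    simp only [quasiResU, quasiResW, quasiA, quasiQ, quasiRemA, quasiRemQ, quasiA₂, quasiA₃,
      quasiQ₂, quasiQ₃, quasiEnergy]
    field_simp
    ring

/-- Every remainder is a continuous function of a bounded parameter and of values of sine and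
cosine, so compactness supplies constants uniform in δ without explicit estimates. -/
theorem exists_abs_le_of_continuous {F : ℝ × ℝ × ℝ → ℝ} (hF : Continuous F) (K : ℝ) :
    ∃ C, 0 ≤ C ∧ ∀ h s c : ℝ, 0 ≤ h → h ≤ K → |s| ≤ 1 → |c| ≤ 1 → |F (h, s, c)| ≤ C := by
  obtain ⟨C, hC⟩ := ((isCompact_Icc (a := (0 : ℝ)) (b := K)).prod
    ((isCompact_Icc (a := (-1 : ℝ)) (b := 1)).prod
      (isCompact_Icc (a := (-1 : ℝ)) (b := 1)))).exists_bound_of_continuousOn hF.continuousOn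
  refine ⟨max C 0, le_max_right _ _, fun h s c h0 hK hs hc => ?_⟩
  have := hC (h, s, c) ⟨⟨h0, hK⟩, abs_le.mp hs, abs_le.mp hc⟩
  exact this.trans (le_max_left _ _)

theorem continuous_quasiResidual (δ κ : ℝ) : Continuous (quasiResidual δ κ) := by
  unfold quasiResidual quasiResU quasiResW quasiU quasiW quasiA₂ quasiA₃ quasiQ₂ quasiQ₃
  fun_prop

/-- The residual carries an explicit factor δ⁶. For the distance to sin(κt)/κ, both A(s)A(0) - 1 and
Q contain the factor (δκ)². -/
theorem exists_abs_quasiResidual_le (K : ℝ) : ∃ C, 0 ≤ C ∧ ∀ δ κ : ℝ, 0 < δ → δ ≤ 1 → 0 < κ →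
    κ ≤ K → ∀ t ∈ Set.Icc (0 : ℝ) 1, |quasiResidual δ κ t| ≤ C * δ ^ 6 ∧
      |quasimode δ κ t - Real.sin (κ * t) / κ| ≤ C * δ ^ 2 := by
  obtain ⟨CA, hCA0, hCA⟩ := exists_abs_le_of_continuous (F := fun p => quasiA p.1 p.2.1)
    (by unfold quasiA quasiRemA quasiA₂ quasiA₃; fun_prop) K
  obtain ⟨CQ, hCQ0, hCQ⟩ := exists_abs_le_of_continuous (F := fun p => quasiQ p.1 p.2.1)
    (by unfold quasiQ quasiRemQ quasiQ₂ quasiQ₃; fun_prop) K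
  obtain ⟨CR, hCR0, hCR⟩ := exists_abs_le_of_continuous (F := fun p => quasiRemQ p.1 p.2.1)
    (by unfold quasiRemQ quasiQ₂ quasiQ₃; fun_prop) K
  obtain ⟨CU, hCU0, hCU⟩ := exists_abs_le_of_continuous (F := fun p => quasiResU p.1 p.2.1)
    (by unfold quasiResU quasiA₂ quasiA₃ quasiQ₃; fun_prop) K
  obtain ⟨CW, hCW0, hCW⟩ := exists_abs_le_of_continuous (F := fun p => quasiResW p.1 p.2.1)
    (by unfold quasiResW quasiQ₂ quasiQ₃; fun_prop) K
  obtain ⟨CX, hCX0, hCX⟩ := exists_abs_le_of_continuous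
    (F := fun p => p.2.1 / 2 + p.1 ^ 2 * (quasiRemA p.1 p.2.1 + quasiRemA p.1 0 * quasiA p.1 p.2.1))
    (by unfold quasiA quasiRemA quasiA₂ quasiA₃; fun_prop) K
  set U := CA + CQ with hU
  set W := CA + |K| * CQ with hW
  refine ⟨max (K ^ 8 * (CU * U + CW * W)) (K ^ 2 * (CX + CA * CR + CR * W)),
    le_max_of_le_left (by positivity), ?_⟩
  intro δ κ hδ hδ1 hκ hκK t ht
  have hK0 : 0 < K := hκ.trans_le hκK
  rw [abs_of_pos hK0] at hW
  have hh0 : 0 ≤ δ * κ := by positivity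
  have hhK : δ * κ ≤ K := by nlinarith
  have hS := abs_sin_mul_div_le hκ ht
  have hs1 := Real.abs_sin_le_one (t / δ)
  have hc1 := Real.abs_cos_le_one (t / δ)
  have hsk := Real.abs_sin_le_one (κ * t)
  have hck := Real.abs_cos_le_one (κ * t)
  have z1 : |(0 : ℝ)| ≤ 1 := by simp
  have bA0 := hCA (δ * κ) 0 0 hh0 hhK z1 z1
  have bQ0 := hCQ (δ * κ) 0 0 hh0 hhK z1 z1
  have bR0 := hCR (δ * κ) 0 0 hh0 hhK z1 z1
  have bA := hCA (δ * κ) _ 0 hh0 hhK hs1 z1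
  have bR := hCR (δ * κ) _ 0 hh0 hhK hs1 z1
  have bU := hCU (δ * κ) _ 0 hh0 hhK hs1 z1
  have bW := hCW (δ * κ) _ 0 hh0 hhK hs1 z1
  have bX := hCX (δ * κ) _ 0 hh0 hhK hs1 z1
  simp only at bA0 bQ0 bR0 bA bR bU bW bX
  have bu : |quasiU δ κ t| ≤ U := by
    unfold quasiU
    refine (abs_sub _ _).trans ?_
    rw [abs_mul, abs_mul, abs_mul, abs_of_pos hδ]
    calc _ ≤ CA * 1 + 1 * CQ * 1 := by gcongr
      _ = U := by rw [hU]; ring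
  have bw : |quasiW δ κ t| ≤ W := by
    unfold quasiW
    refine (abs_add_le _ _).trans ?_
    rw [abs_mul, abs_mul, abs_mul, abs_of_nonneg hh0]
    calc _ ≤ CA * 1 + K * CQ * 1 := by gcongr
      _ = W := by rw [hW]; ring
  have hW0 : 0 ≤ W := (abs_nonneg _).trans bw
  constructor
  · calc |quasiResidual δ κ t| ≤ δ ^ 6 * K ^ 8 * (CU * U + 1 * 1 * CW * W) := by
          unfold quasiResidual
          rw [abs_mul, abs_of_nonneg (by positivity : 0 ≤ δ ^ 6 * κ ^ 8)]
          gcongr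
          refine (abs_add_le _ _).trans ?_
          rw [abs_mul, abs_mul, abs_mul, abs_mul, abs_of_pos hδ]
          gcongr
      _ = K ^ 8 * (CU * U + CW * W) * δ ^ 6 := by ring
      _ ≤ _ := by
          gcongr
          exact le_max_left _ _
  · have key : quasimode δ κ t - Real.sin (κ * t) / κ = (δ * κ) ^ 2 *
        ((Real.sin (t / δ) / 2 + (δ * κ) ^ 2 * (quasiRemA (δ * κ) (Real.sin (t / δ))
          + quasiRemA (δ * κ) 0 * quasiA (δ * κ) (Real.sin (t / δ)))) * (Real.sin (κ * t) / κ)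
          - δ * (quasiA (δ * κ) (Real.sin (t / δ)) * quasiRemQ (δ * κ) 0) * Real.cos (κ * t)
          + δ * Real.cos (t / δ) * quasiRemQ (δ * κ) (Real.sin (t / δ)) * quasiW δ κ t) := by
      simp only [quasimode, quasiU, quasiQ, quasiA]
      ring
    rw [key, abs_mul, abs_of_nonneg (by positivity : 0 ≤ (δ * κ) ^ 2)]
    calc _ ≤ (δ * K) ^ 2 * (CX * 1 + 1 * (CA * CR) * 1 + 1 * 1 * CR * W) := by
          gcongr
          refine (abs_add_le _ _).trans ?_
          refine add_le_add ((abs_sub _ _).trans ?_) ?_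
          · rw [abs_mul, abs_mul, abs_mul, abs_mul, abs_of_pos hδ]
            gcongr
          · rw [abs_mul, abs_mul, abs_mul, abs_of_pos hδ]
            gcongr
      _ = K ^ 2 * (CX + CA * CR + CR * W) * δ ^ 2 := by ring
      _ ≤ _ := by
          gcongr
          exact le_max_right _ _

/-! ### The boundary condition at 1 and the energy -/

/-- The wave number of the quasimode is `N + δ ^ 3 * quasiShift N δ s c`, where `s`, `c` are the
sine and cosine of `1 / δ` and `N` is a multiple of `π`. -/
def quasiShift (N δ s c : ℝ) : ℝ :=
  N ^ 3 * (1 - c) + δ ^ 2 * N ^ 5 * (31 / 8 * (1 - c) + 5 / 16 * (s * c))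

/-- A quadratic error suffices: it is used for d = O(δ³), where d² is already O(δ⁶). -/
theorem abs_sin_sub_self_le {d : ℝ} (hd : |d| ≤ 1) : |Real.sin d - d| ≤ d ^ 2 := by
  have h := Real.sin_bound hd
  have h1 : |d| ^ 2 = d ^ 2 := sq_abs d
  have h0 := abs_nonneg d
  have h3 : |d ^ 3 / 6| ≤ d ^ 2 / 6 := by
    rw [abs_div, abs_pow, abs_of_pos (by norm_num : (0 : ℝ) < 6), ← h1]
    have : |d| ^ 3 ≤ |d| ^ 2 := pow_le_pow_of_le_one h0 hd (by norm_num)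
    linarith
  have h4 : |d| ^ 4 ≤ |d| ^ 2 := pow_le_pow_of_le_one h0 hd (by norm_num)
  have e : Real.sin d - d = Real.sin d - (d - d ^ 3 / 6) - d ^ 3 / 6 := by ring
  rw [e]
  refine (abs_sub _ _).trans ?_
  nlinarith [sq_nonneg d]

theorem abs_cos_sub_one_le (d : ℝ) : |Real.cos d - 1| ≤ d ^ 2 := by
  rw [abs_le]
  constructor <;> nlinarith [Real.one_sub_sq_div_two_le_cos (x := d), Real.cos_le_one d, sq_nonneg d]

/-- The algebraic identity behind the choice of `quasiShift`. -/
theorem quasi_boundary_identity (N δ s c e κ h : ℝ) (he : e = quasiShift N δ s c)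
    (hκ : κ = N + δ ^ 3 * e) (hh : h = δ * κ) :
    δ ^ 3 * e * (quasiA h s * quasiA h 0 + h ^ 2 * c * quasiQ h s * quasiQ h 0)
      + h * (c * quasiQ h s * quasiA h 0 - quasiA h s * quasiQ h 0)
    = δ ^ 6 * (-e * ((κ ^ 2 + κ * N + N ^ 2) * (1 - c)
        + δ ^ 2 * (κ ^ 4 + κ ^ 3 * N + κ ^ 2 * N ^ 2 + κ * N ^ 3 + N ^ 4)
          * (31 / 8 * (1 - c) + 5 / 16 * (s * c)))
        * (quasiA h s * quasiA h 0 + h ^ 2 * c * quasiQ h s * quasiQ h 0)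
      + δ * κ ^ 7 * ((1 - c + h ^ 2 * (31 / 8 * (1 - c) + 5 / 16 * (s * c)))
          * (quasiRemA h s + quasiRemA h 0 * quasiA h s
            + h ^ 2 * c * quasiRemQ h s * quasiRemQ h 0)
        + (31 / 8 * (1 - c) + 5 / 16 * (s * c)) * (s / 2)
        + c * quasiQ₃ s - quasiQ₃ 0 - s / 2 * (quasiQ₂ 0 + h ^ 2 * quasiQ₃ 0)
        + c * quasiRemQ h s * quasiRemA h 0 - quasiRemA h s * quasiRemQ h 0)) := by
  -- The shift is explicit in N, whereas the cancellation below is exact in h = δκ. Passing from N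
  -- to κ costs factors κ³ - N³ and κ⁵ - N⁵, divisible by κ - N = δ³e, hence only O(δ⁶).
  have hd : δ ^ 3 * e = h ^ 3 * (1 - c) + h ^ 5 * (31 / 8 * (1 - c) + 5 / 16 * (s * c))
      - δ ^ 6 * e * ((κ ^ 2 + κ * N + N ^ 2) * (1 - c)
        + δ ^ 2 * (κ ^ 4 + κ ^ 3 * N + κ ^ 2 * N ^ 2 + κ * N ^ 3 + N ^ 4)
          * (31 / 8 * (1 - c) + 5 / 16 * (s * c))) := by
    have e1 : δ ^ 3 * e = κ - N := by rw [hκ]; ring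
    have e2 : δ ^ 6 * e = δ ^ 3 * (κ - N) := by rw [hκ]; ring
    rw [e2, hh, he, quasiShift]
    ring
  -- The coefficients 1 - c and 31/8 (1 - c) + 5/16 s c are exactly those that cancel the orders h³
  -- and h⁵; everything left contains h⁷.
  have hw : (h ^ 3 * (1 - c) + h ^ 5 * (31 / 8 * (1 - c) + 5 / 16 * (s * c)))
        * (quasiA h s * quasiA h 0 + h ^ 2 * c * quasiQ h s * quasiQ h 0)
      + h * (c * quasiQ h s * quasiA h 0 - quasiA h s * quasiQ h 0)
      = h ^ 7 * ((1 - c + h ^ 2 * (31 / 8 * (1 - c) + 5 / 16 * (s * c)))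
          * (quasiRemA h s + quasiRemA h 0 * quasiA h s
            + h ^ 2 * c * quasiRemQ h s * quasiRemQ h 0)
        + (31 / 8 * (1 - c) + 5 / 16 * (s * c)) * (s / 2)
        + c * quasiQ₃ s - quasiQ₃ 0 - s / 2 * (quasiQ₂ 0 + h ^ 2 * quasiQ₃ 0)
        + c * quasiRemQ h s * quasiRemA h 0 - quasiRemA h s * quasiRemQ h 0) := by
    have e0 : quasiQ₂ s = 31 / 8 + 3 / 16 * s := rfl
    have e1 : quasiQ₂ 0 = 31 / 8 := by norm_num [quasiQ₂]
    simp only [quasiQ, quasiRemQ, quasiA, e0, e1]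
    ring
  have h7 : h ^ 7 = δ ^ 7 * κ ^ 7 := by rw [hh]; ring
  rw [h7] at hw
  linear_combination hw + (quasiA h s * quasiA h 0 + h ^ 2 * c * quasiQ h s * quasiQ h 0) * hd

/-- The quasimode nearly vanishes at `1`. -/
theorem exists_abs_quasimode_one_le (n : ℕ) : ∃ C, 0 ≤ C ∧ ∀ δ e κ : ℝ, 0 < δ → δ ≤ 1 →
    e = quasiShift (n * Real.pi) δ (Real.sin (1 / δ)) (Real.cos (1 / δ)) →
    κ = n * Real.pi + δ ^ 3 * e → 1 ≤ κ → |δ ^ 3 * e| ≤ 1 → |quasimode δ κ 1| ≤ C * δ ^ 6 := by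
  set N : ℝ := n * Real.pi with hN
  set eF : ℝ × ℝ × ℝ → ℝ := fun p => quasiShift N p.1 p.2.1 p.2.2 with heF
  have ceF : Continuous eF := by
    rw [heF]; unfold quasiShift; fun_prop
  set kF : ℝ × ℝ × ℝ → ℝ := fun p => N + p.1 ^ 3 * eF p with hkF
  have ckF : Continuous kF := by fun_prop
  set hF : ℝ × ℝ × ℝ → ℝ := fun p => p.1 * kF p with hhF
  have chF : Continuous hF := by fun_prop
  set F : ℝ × ℝ × ℝ → ℝ := fun p => quasiA (hF p) p.2.1 * quasiA (hF p) 0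
    + hF p ^ 2 * p.2.2 * quasiQ (hF p) p.2.1 * quasiQ (hF p) 0 with hFF
  have cF : Continuous F := by
    rw [hFF]
    unfold quasiA quasiQ quasiRemA quasiRemQ quasiA₂ quasiA₃ quasiQ₂ quasiQ₃
    fun_prop
  obtain ⟨C₁, hC₁0, hC₁⟩ := exists_abs_le_of_continuous (F := fun p => eF p ^ 2 * F p)
    (by fun_prop) 1
  obtain ⟨C₂, hC₂0, hC₂⟩ := exists_abs_le_of_continuous (F := fun p => eF p ^ 2 *
      (hF p * (p.2.2 * quasiQ (hF p) p.2.1 * quasiA (hF p) 0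
        - quasiA (hF p) p.2.1 * quasiQ (hF p) 0)))
    (by unfold quasiA quasiQ quasiRemA quasiRemQ quasiA₂ quasiA₃ quasiQ₂ quasiQ₃; fun_prop) 1
  obtain ⟨C₃, hC₃0, hC₃⟩ := exists_abs_le_of_continuous (F := fun p =>
      -eF p * ((kF p ^ 2 + kF p * N + N ^ 2) * (1 - p.2.2)
        + p.1 ^ 2 * (kF p ^ 4 + kF p ^ 3 * N + kF p ^ 2 * N ^ 2 + kF p * N ^ 3 + N ^ 4)
          * (31 / 8 * (1 - p.2.2) + 5 / 16 * (p.2.1 * p.2.2))) * F p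
      + p.1 * kF p ^ 7 *
        ((1 - p.2.2 + hF p ^ 2 * (31 / 8 * (1 - p.2.2) + 5 / 16 * (p.2.1 * p.2.2)))
          * (quasiRemA (hF p) p.2.1 + quasiRemA (hF p) 0 * quasiA (hF p) p.2.1
            + hF p ^ 2 * p.2.2 * quasiRemQ (hF p) p.2.1 * quasiRemQ (hF p) 0)
        + (31 / 8 * (1 - p.2.2) + 5 / 16 * (p.2.1 * p.2.2)) * (p.2.1 / 2)
        + p.2.2 * quasiQ₃ p.2.1 - quasiQ₃ 0
        - p.2.1 / 2 * (quasiQ₂ 0 + hF p ^ 2 * quasiQ₃ 0)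
        + p.2.2 * quasiRemQ (hF p) p.2.1 * quasiRemA (hF p) 0
        - quasiRemA (hF p) p.2.1 * quasiRemQ (hF p) 0))
    (by unfold quasiA quasiRemA quasiRemQ quasiA₂ quasiA₃ quasiQ₂ quasiQ₃; fun_prop) 1
  refine ⟨C₁ + C₂ + C₃, by positivity, ?_⟩
  intro δ e κ hδ hδ1 he hκ hκ1 hd1
  have hs1 := Real.abs_sin_le_one (1 / δ)
  have hc1 := Real.abs_cos_le_one (1 / δ)
  have b₁ := hC₁ δ _ _ hδ.le hδ1 hs1 hc1
  have b₂ := hC₂ δ _ _ hδ.le hδ1 hs1 hc1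
  have b₃ := hC₃ δ _ _ hδ.le hδ1 hs1 hc1
  simp only [hFF, hhF, hkF, heF, ← he, ← hκ] at b₁ b₂ b₃
  have hid := quasi_boundary_identity N δ _ _ e κ (δ * κ) he hκ rfl
  have hmode : quasimode δ κ 1 = quasiA (δ * κ) (Real.sin (1 / δ)) *
        (quasiA (δ * κ) 0 * (Real.sin κ / κ) - δ * quasiQ (δ * κ) 0 * Real.cos κ)
      + δ * Real.cos (1 / δ) * quasiQ (δ * κ) (Real.sin (1 / δ)) *
        (quasiA (δ * κ) 0 * Real.cos κ + δ * κ * quasiQ (δ * κ) 0 * Real.sin κ) := by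
    simp only [quasimode, quasiU, quasiW, mul_one]
  have hsinκ : Real.sin κ = (-1) ^ n * Real.sin (δ ^ 3 * e) := by
    rw [hκ, hN, sin_nat_mul_pi_add]
  have hcosκ : Real.cos κ = (-1) ^ n * Real.cos (δ ^ 3 * e) := by
    rw [hκ, hN, cos_nat_mul_pi_add]
  have hσ := abs_sin_sub_self_le hd1
  have hχ := abs_cos_sub_one_le (δ ^ 3 * e)
  rw [hsinκ, hcosκ] at hmode
  set d := δ ^ 3 * e with hd
  set s := Real.sin (1 / δ)
  set c := Real.cos (1 / δ)
  have hd2 : d ^ 2 = δ ^ 6 * e ^ 2 := by rw [hd]; ring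
  rw [hd2] at hσ hχ
  clear_value s c d
  obtain ⟨X, hX⟩ : ∃ X, X = quasiA (δ * κ) s * quasiA (δ * κ) 0
    + (δ * κ) ^ 2 * c * quasiQ (δ * κ) s * quasiQ (δ * κ) 0 := ⟨_, rfl⟩
  obtain ⟨Z, hZ⟩ : ∃ Z, Z = δ * κ * (c * quasiQ (δ * κ) s * quasiA (δ * κ) 0
    - quasiA (δ * κ) s * quasiQ (δ * κ) 0) := ⟨_, rfl⟩
  rw [← hX] at b₁ b₃ hid
  rw [← hZ] at b₂ hid
  have hκ0 : 0 < κ := by linarith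
  -- By the addition formulas the end value times κ is ±(X sin d + Z cos d). Its linearisation d X +
  -- Z is handled by `quasi_boundary_identity`; the rest is O(d²).
  have hmul : κ * quasimode δ κ 1
      = (-1) ^ n * ((d * X + Z) + (Real.sin d - d) * X + (Real.cos d - 1) * Z) := by
    rw [hmode, hX, hZ]
    field_simp
    ring
  have hle : |quasimode δ κ 1| ≤ |κ * quasimode δ κ 1| := by
    rw [abs_mul, abs_of_pos hκ0]
    exact le_mul_of_one_le_left (abs_nonneg _) hκ1
  refine hle.trans ?_
  rw [hmul, abs_mul, abs_pow, abs_neg, abs_one, one_pow, one_mul, hid]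
  have hδ6 : 0 < δ ^ 6 := by positivity
  have t1 : |(Real.sin d - d) * X| ≤ δ ^ 6 * C₁ := by
    rw [abs_mul]
    calc _ ≤ δ ^ 6 * e ^ 2 * |X| := by gcongr
      _ = δ ^ 6 * |e ^ 2 * X| := by rw [abs_mul, abs_of_nonneg (sq_nonneg e)]; ring
      _ ≤ _ := by gcongr
  have t2 : |(Real.cos d - 1) * Z| ≤ δ ^ 6 * C₂ := by
    rw [abs_mul]
    calc _ ≤ δ ^ 6 * e ^ 2 * |Z| := by gcongr
      _ = δ ^ 6 * |e ^ 2 * Z| := by rw [abs_mul, abs_of_nonneg (sq_nonneg e)]; ring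
      _ ≤ _ := by gcongr
  refine (abs_add_le _ _).trans ?_
  refine (add_le_add_left (abs_add_le _ _) _).trans ?_
  rw [abs_mul (δ ^ 6), abs_of_pos hδ6]
  have t3 := mul_le_mul_of_nonneg_left b₃ hδ6.le
  linarith

/-- Expansion of the energy of the quasimode. -/
theorem exists_abs_quasiEnergy_sub_le (N : ℝ) : ∃ C, 0 ≤ C ∧ ∀ δ s c e κ : ℝ, 0 < δ → δ ≤ 1 →
    |s| ≤ 1 → |c| ≤ 1 → e = quasiShift N δ s c → κ = N + δ ^ 3 * e →
    |quasiEnergy δ κ - (N ^ 2 / 2 - δ ^ 2 * N ^ 4 / 16 + δ ^ 3 * N ^ 4 * (1 - c)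
      - 15 / 64 * δ ^ 4 * N ^ 6 + δ ^ 5 * N ^ 6 * (29 / 8 * (1 - c) + 5 / 16 * (s * c)))|
      ≤ C * δ ^ 6 := by
  set eF : ℝ × ℝ × ℝ → ℝ := fun p => quasiShift N p.1 p.2.1 p.2.2 with heF
  have ceF : Continuous eF := by
    rw [heF]; unfold quasiShift; fun_prop
  set kF : ℝ × ℝ × ℝ → ℝ := fun p => N + p.1 ^ 3 * eF p with hkF
  have ckF : Continuous kF := by fun_prop
  obtain ⟨C, hC0, hC⟩ := exists_abs_le_of_continuous (F := fun p => eF p ^ 2 / 2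
      - 1 / 16 * (4 * p.1 * N ^ 8 * (31 / 8 * (1 - p.2.2) + 5 / 16 * (p.2.1 * p.2.2))
        + p.1 ^ 2 * eF p ^ 2 * (6 * N ^ 2 + 4 * N * p.1 ^ 3 * eF p + p.1 ^ 6 * eF p ^ 2))
      - 15 / 64 * p.1 * eF p * (kF p ^ 5 + kF p ^ 4 * N + kF p ^ 3 * N ^ 2 + kF p ^ 2 * N ^ 3
        + kF p * N ^ 4 + N ^ 5)) (by fun_prop) 1
  refine ⟨C, hC0, fun δ s c e κ hδ hδ1 hs hc he hκ => ?_⟩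
  have b := hC δ s c hδ.le hδ1 hs hc
  simp only [hkF, heF, ← he, ← hκ] at b
  have h6 : (0 : ℝ) < δ ^ 6 := by positivity
  have key : quasiEnergy δ κ - (N ^ 2 / 2 - δ ^ 2 * N ^ 4 / 16 + δ ^ 3 * N ^ 4 * (1 - c)
      - 15 / 64 * δ ^ 4 * N ^ 6 + δ ^ 5 * N ^ 6 * (29 / 8 * (1 - c) + 5 / 16 * (s * c)))
      = δ ^ 6 * (e ^ 2 / 2 - 1 / 16 * (4 * δ * N ^ 8 * (31 / 8 * (1 - c) + 5 / 16 * (s * c))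
        + δ ^ 2 * e ^ 2 * (6 * N ^ 2 + 4 * N * δ ^ 3 * e + δ ^ 6 * e ^ 2))
        - 15 / 64 * δ * e * (κ ^ 5 + κ ^ 4 * N + κ ^ 3 * N ^ 2 + κ ^ 2 * N ^ 3
          + κ * N ^ 4 + N ^ 5)) := by
    unfold quasiShift at he
    rw [quasiEnergy, hκ]
    -- The shift is substituted only in the terms linear in e coming from κ²/2 and -δ²κ⁴/16. The
    -- second lowers 31/8 by 1/4, whence 29/8.
    linear_combination (N * δ ^ 3 - δ ^ 5 * N ^ 3 / 4) * he
  rw [key, abs_mul, abs_of_pos h6, mul_comm]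
  gcongr

/-! ### From the quasimode to the eigenvalue -/

/-- If a forced string and an eigenfunction are both close to `sin (N t) / N`, then the energies
differ by at most the size of the defects. -/
theorem abs_energy_sub_le {δ E F N σ R b Λ : ℝ} {r f g y v : ℝ → ℝ} (hN : 1 ≤ N)
    (hs : Real.sin N = 0) (h : IsForcedString (sinDensity δ) E r f g)
    (hr : Continuous r) (hy : IsShooting (sinDensity δ) F y v) (hf0 : f 0 = 0) (hy1 : y 1 = 0)
    (hσ : 36 * σ ≤ 1 / N ^ 2)
    (hfσ : ∀ t ∈ Set.Icc (0 : ℝ) 1, |f t - Real.sin (N * t) / N| ≤ σ)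
    (hyσ : ∀ t ∈ Set.Icc (0 : ℝ) 1, |y t - Real.sin (N * t) / N| ≤ σ)
    (hrR : ∀ t ∈ Set.Icc (0 : ℝ) 1, |r t| ≤ R) (hf1 : |f 1| ≤ b)
    (hyΛ : ∀ t ∈ Set.Icc (0 : ℝ) 1, |y t| ≤ Λ ∧ |v t| ≤ Λ) :
    |F - E| ≤ 4 * N ^ 2 * ((b + R) * Λ) := by
  have hΛ0 : 0 ≤ Λ := (abs_nonneg _).trans (hyΛ 0 (by simp)).1
  have hN2 : 1 ≤ N ^ 2 := one_le_pow₀ hN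
  have hσ1 : σ ≤ 1 := by
    have : 1 / N ^ 2 ≤ 1 := (div_le_one (by positivity)).mpr hN2
    linarith
  have key := h.wronskian_eq hy.toIsForcedString (continuous_sinDensity δ) hr.continuousOn
  have hpos := le_integral_mul_of_close (continuous_sinDensity δ) (one_le_sinDensity δ)
    (sinDensity_le δ) hN hs h.continuousOn_fst hy.continuousOn_fst hσ1 hfσ hyσ
  have hint : |∫ t in (0 : ℝ)..1, r t * y t| ≤ R * Λ := by
    have := intervalIntegral.norm_integral_le_of_norm_le_const (a := 0) (b := 1)
      (f := fun t => r t * y t) (C := R * Λ) (fun t ht => by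
        rw [Set.uIoc_of_le zero_le_one] at ht
        have ht' := Set.Ioc_subset_Icc_self ht
        rw [Real.norm_eq_abs, abs_mul]
        exact mul_le_mul (hrR t ht') (hyΛ t ht').1 (abs_nonneg _)
          ((abs_nonneg _).trans (hrR t ht')))
    simpa using this
  simp only [hy1, hf0, hy.fst_zero, zero_mul, mul_zero, sub_zero, zero_sub] at key
  set J := ∫ t in (0 : ℝ)..1, sinDensity δ t * f t * y t
  set T := ∫ t in (0 : ℝ)..1, r t * y t
  -- The hypothesis on σ says 9σ ≤ 1/(4N²), so half of the main term 1/(2N²) survives.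
  have hJ : 1 / (4 * N ^ 2) ≤ J := by
    have e1 : 1 / (2 * N ^ 2) = 1 / N ^ 2 / 2 := by field_simp
    have e2 : 1 / (4 * N ^ 2) = 1 / N ^ 2 / 4 := by field_simp
    linarith
  have hv : |f 1 * v 1| ≤ b * Λ := by
    rw [abs_mul]
    exact mul_le_mul hf1 (hyΛ 1 (by simp)).2 (abs_nonneg _) ((abs_nonneg _).trans hf1)
  have hprod : |F - E| * J ≤ (b + R) * Λ := by
    have hJ0 : 0 ≤ J := le_trans (by positivity) hJ
    have e : |F - E| * J = |-(f 1 * v 1) - T| := by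
      rw [← eq_sub_of_add_eq key, abs_mul, abs_of_nonneg hJ0]
    rw [e]
    refine (abs_sub _ _).trans ?_
    rw [abs_neg]
    linarith
  have h1 : |F - E| * (1 / (4 * N ^ 2)) ≤ (b + R) * Λ :=
    (mul_le_mul_of_nonneg_left hJ (abs_nonneg _)).trans hprod
  rw [mul_one_div, div_le_iff₀ (by positivity)] at h1
  linarith

/-- The asymptotic expansion of the eigenvalues. -/
theorem exists_isNthStringEigenvalue_expansion {n : ℕ} (hn : 1 ≤ n) :
    ∃ C δ₀, 0 < δ₀ ∧ ∀ δ, 0 < δ → δ < δ₀ → ∃ E,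
      IsNthStringEigenvalue (1 / 2) (fun x => sinDensity δ (x + 1 / 2)) n E ∧
      |E - ((n * Real.pi) ^ 2 / 2 - δ ^ 2 * (n * Real.pi) ^ 4 / 16
        + δ ^ 3 * (n * Real.pi) ^ 4 * (1 - Real.cos (1 / δ)) - 15 / 64 * δ ^ 4 * (n * Real.pi) ^ 6
        + δ ^ 5 * (n * Real.pi) ^ 6 * (29 / 8 * (1 - Real.cos (1 / δ))
          + 5 / 16 * (Real.sin (1 / δ) * Real.cos (1 / δ))))| ≤ C * δ ^ 6 := by
  have hsinN : Real.sin (n * Real.pi) = 0 := Real.sin_nat_mul_pi n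
  have hN3 : 3 ≤ n * Real.pi := by
    have : (1 : ℝ) ≤ n := by exact_mod_cast hn
    nlinarith [Real.pi_gt_three]
  obtain ⟨C₁, hC₁0, hC₁⟩ := exists_abs_quasiEnergy_sub_le (n * Real.pi)
  obtain ⟨C₂, hC₂0, hC₂⟩ := exists_abs_quasimode_one_le n
  obtain ⟨C₃, hC₃0, hC₃⟩ := exists_abs_quasiResidual_le (n * Real.pi + 1)
  obtain ⟨C₄, hC₄0, hC₄⟩ := exists_abs_shooting_sub_sin_le (n * Real.pi + 1)
  obtain ⟨C₅, hC₅0, hC₅⟩ := exists_abs_le_of_continuous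
    (F := fun p => quasiShift (n * Real.pi) p.1 p.2.1 p.2.2) (by unfold quasiShift; fun_prop) 1
  set N : ℝ := n * Real.pi with hN
  -- Chosen so that σ = 4θ meets 36σ ≤ 1/N². The distance of each function to sin(Nt)/N is at most θ
  -- from its approximation and 2θ from the change of wave number.
  set θ : ℝ := 1 / (144 * N ^ 2) with hθ
  have hθ0 : 0 < θ := by positivity
  have hθ1 : θ ≤ 1 := by
    rw [hθ, div_le_one (by positivity)]
    nlinarith
  obtain ⟨δ₁, hδ₁, hex⟩ := exists_isNthStringEigenvalue hn hθ0
  set M := (N + 1) ^ 2 / 2 with hM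
  set Λ := Real.exp (1 + M * 3) with hΛ
  have hD0 : 0 < C₃ + C₄ + C₅ + 1 := by positivity
  refine ⟨4 * N ^ 2 * ((C₂ + C₃) * Λ) + C₁, min (min 1 δ₁) (θ / (C₃ + C₄ + C₅ + 1)),
    lt_min (lt_min one_pos hδ₁) (by positivity), fun δ hδ hδ₀ => ?_⟩
  have hδ1 : δ ≤ 1 := hδ₀.le.trans ((min_le_left _ _).trans (min_le_left _ _))
  have hδθ : δ ≤ θ / (C₃ + C₄ + C₅ + 1) := hδ₀.le.trans (min_le_right _ _)
  rw [le_div_iff₀ hD0] at hδθ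
  obtain ⟨κ, hκN, hκ⟩ := hex δ hδ (hδ₀.trans_le ((min_le_left _ _).trans (min_le_right _ _)))
  refine ⟨κ ^ 2 / 2, hκ, ?_⟩
  obtain ⟨y, v, hy⟩ := exists_isShooting (continuous_sinDensity δ) (abs_sinDensity_le δ) (κ ^ 2 / 2)
  have hy1 : y 1 = 0 := (hy.isStringEigenvalue_iff (abs_sinDensity_le δ)).mp hκ.1
  have hκ' := abs_le.mp hκN
  have hs1 := Real.abs_sin_le_one (1 / δ)
  have hc1 := Real.abs_cos_le_one (1 / δ)
  obtain ⟨e, he⟩ : ∃ e, e = quasiShift N δ (Real.sin (1 / δ)) (Real.cos (1 / δ)) := ⟨_, rfl⟩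
  obtain ⟨μ, hμ⟩ : ∃ μ, μ = N + δ ^ 3 * e := ⟨_, rfl⟩
  have hbe : |e| ≤ C₅ := by
    rw [he]
    exact hC₅ δ _ _ hδ.le hδ1 hs1 hc1
  have hp1 : C₃ * δ ≤ θ := by nlinarith [mul_nonneg hC₄0 hδ.le, mul_nonneg hC₅0 hδ.le]
  have hp2 : C₄ * δ ≤ θ := by nlinarith [mul_nonneg hC₃0 hδ.le, mul_nonneg hC₅0 hδ.le]
  have hp3 : C₅ * δ ≤ θ := by nlinarith [mul_nonneg hC₃0 hδ.le, mul_nonneg hC₄0 hδ.le]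
  have hd : |δ ^ 3 * e| ≤ θ := by
    rw [abs_mul, abs_of_pos (by positivity : 0 < δ ^ 3)]
    have : δ ^ 3 ≤ δ ^ 1 := pow_le_pow_of_le_one hδ.le hδ1 (by norm_num)
    calc δ ^ 3 * |e| ≤ δ ^ 1 * C₅ := by gcongr
      _ ≤ θ := by linarith
  have hμN : |μ - N| ≤ θ := by
    rw [hμ, add_sub_cancel_left]
    exact hd
  have hμ' := abs_le.mp hμN
  have hμ0 : 0 < μ := by linarith
  have hμK : μ ≤ N + 1 := by linarith
  obtain ⟨g, hg⟩ := exists_isForcedString_quasimode hδ.ne' hμ0.ne'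
  have hδ2 : C₃ * δ ^ 2 ≤ θ := by
    have : δ ^ 2 ≤ δ ^ 1 := pow_le_pow_of_le_one hδ.le hδ1 (by norm_num)
    calc C₃ * δ ^ 2 ≤ C₃ * δ ^ 1 := by gcongr
      _ ≤ θ := by linarith
  have hκM : |κ ^ 2 / 2| ≤ M := by
    rw [abs_of_nonneg (by positivity), hM]
    have : 0 ≤ κ := by linarith
    have : κ ≤ N + 1 := by linarith
    gcongr
  have hmain := abs_energy_sub_le (N := N) (σ := 4 * θ) (R := C₃ * δ ^ 6) (b := C₂ * δ ^ 6)
    (Λ := Λ) (by linarith) hsinN hg (continuous_quasiResidual δ μ) hy (quasimode_zero δ μ) hy1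
    (by
      have : 1 / N ^ 2 = 144 * θ := by rw [hθ]; field_simp
      rw [this]
      linarith)
    (fun t ht => by
      have h1 := (hC₃ δ μ hδ hδ1 hμ0 hμK t ht).2
      have h2 := abs_sin_mul_div_sub_le (by linarith : 1 ≤ μ) (by linarith : 1 ≤ N) ht
      have h3 := abs_sub_le (quasimode δ μ t) (Real.sin (μ * t) / μ) (Real.sin (N * t) / N)
      linarith)
    (fun t ht => by
      have h1 := hC₄ δ κ hδ hδ1 (by linarith) (by linarith) y v hy t ht
      have h2 := abs_sin_mul_div_sub_le (by linarith : 1 ≤ κ) (by linarith : 1 ≤ N) ht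
      have h3 := abs_sub_le (y t) (Real.sin (κ * t) / κ) (Real.sin (N * t) / N)
      linarith)
    (fun t ht => (hC₃ δ μ hδ hδ1 hμ0 hμK t ht).1)
    (hC₂ δ e μ hδ hδ1 he hμ (by linarith) (hd.trans hθ1))
    (fun t ht => hy.abs_le (abs_sinDensity_le δ) hκM ht)
  have hE := hC₁ δ _ _ e μ hδ hδ1 hs1 hc1 he hμ
  refine (abs_sub_le _ (quasiEnergy δ μ) _).trans ?_
  calc _ ≤ 4 * N ^ 2 * ((C₂ * δ ^ 6 + C₃ * δ ^ 6) * Λ) + C₁ * δ ^ 6 := add_le_add hmain hE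
    _ = _ := by ring

/-! ### Return to ε and the stated expansions -/

theorem oscDensity_eq {ε : ℝ} (hε : ε ≠ 0) :
    oscDensity ε = fun x => sinDensity (ε / (2 * Real.pi)) (x + 1 / 2) := by
  funext x
  unfold oscDensity sinDensity
  congr 2
  have := Real.pi_ne_zero
  field_simp

/-- The expansion of the `n`-th eigenvalue up to and including the order `ε ^ 5`. -/
theorem exists_oscEigenvalue_expansion {n : ℕ} (hn : 1 ≤ n) :
    ∃ C, ∀ᶠ ε : ℝ in 𝓝[>] 0,
      IsNthStringEigenvalue (1 / 2) (oscDensity ε) n (oscEigenvalue n ε) ∧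
      |oscEigenvalue n ε - (Real.pi ^ 2 * n ^ 2 / 2 - Real.pi ^ 2 * n ^ 4 / 64 * ε ^ 2
        + Real.pi * n ^ 4 / 4 * Real.sin (Real.pi / ε) ^ 2 * ε ^ 3
        - 15 * Real.pi ^ 2 * n ^ 6 / 1024 * ε ^ 4
        + Real.pi * n ^ 6 * (5 * Real.sin (4 * Real.pi / ε) - 116 * Real.cos (2 * Real.pi / ε)
            + 116) / 1024 * ε ^ 5)| ≤ C * ε ^ 6 := by
  obtain ⟨C, δ₀, hδ₀, h⟩ := exists_isNthStringEigenvalue_expansion hn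
  have hpi := Real.pi_pos
  refine ⟨C / (2 * Real.pi) ^ 6, ?_⟩
  filter_upwards [Ioo_mem_nhdsGT (by positivity : 0 < 2 * Real.pi * δ₀)] with ε hε
  have hε0 := hε.1
  obtain ⟨E, hE, hle⟩ := h (ε / (2 * Real.pi)) (by positivity) (by
    rw [div_lt_iff₀ (by positivity)]
    linarith [hε.2])
  rw [← oscDensity_eq hε0.ne'] at hE
  have heq : oscEigenvalue n ε = E := hE.eq_stringEigenvalue
  rw [heq]
  refine ⟨hE, ?_⟩
  have hinv : 1 / (ε / (2 * Real.pi)) = 2 * Real.pi / ε := by field_simp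
  rw [hinv] at hle
  have hsin4 : Real.sin (4 * Real.pi / ε)
      = 2 * Real.sin (2 * Real.pi / ε) * Real.cos (2 * Real.pi / ε) := by
    rw [← Real.sin_two_mul]
    congr 1
    ring
  have hcos2 : Real.cos (2 * Real.pi / ε) = 1 - 2 * Real.sin (Real.pi / ε) ^ 2 := by
    rw [show 2 * Real.pi / ε = 2 * (Real.pi / ε) by ring, Real.cos_two_mul]
    linarith [Real.sin_sq_add_cos_sq (Real.pi / ε)]
  have hsq : Real.sin (Real.pi / ε) ^ 2 = (1 - Real.cos (2 * Real.pi / ε)) / 2 := by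
    rw [hcos2]; ring
  rw [hsin4, hsq]
  convert hle using 1
  · congr 2
    field_simp
    ring
  · field_simp

/-- The expansion of the `n`-th eigenvalue up to and including the order `ε ^ 3`. -/
theorem oscEigenvalue_isBigO {n : ℕ} (hn : 1 ≤ n) :
    (fun ε : ℝ => oscEigenvalue n ε - (Real.pi ^ 2 * n ^ 2 / 2 - Real.pi ^ 2 * n ^ 4 / 64 * ε ^ 2
        + Real.pi * n ^ 4 / 4 * Real.sin (Real.pi / ε) ^ 2 * ε ^ 3))
      =O[𝓝[>] 0] fun ε : ℝ => ε ^ 4 := by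
  obtain ⟨C, hC⟩ := exists_oscEigenvalue_expansion hn
  have hpi := Real.pi_pos
  -- Here 237 = 5 + 116 + 116 bounds the trigonometric factor at order ε⁵.
  refine IsBigO.of_bound (|C| + (15 * Real.pi ^ 2 * n ^ 6 / 1024
    + Real.pi * n ^ 6 * 237 / 1024)) ?_
  filter_upwards [hC, Ioo_mem_nhdsGT one_pos] with ε hε hε1
  have h0 := hε1.1
  have hle := hε.2
  set S := Real.pi * n ^ 6 * (5 * Real.sin (4 * Real.pi / ε) - 116 * Real.cos (2 * Real.pi / ε)
    + 116) / 1024 with hS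
  have hSb : |S| ≤ Real.pi * n ^ 6 * 237 / 1024 := by
    rw [hS, abs_div, abs_mul, abs_of_nonneg (by positivity : 0 ≤ Real.pi * (n : ℝ) ^ 6),
      abs_of_pos (by norm_num : (0 : ℝ) < 1024)]
    gcongr
    rw [abs_le]
    constructor <;> linarith [Real.neg_one_le_sin (4 * Real.pi / ε),
      Real.sin_le_one (4 * Real.pi / ε), Real.neg_one_le_cos (2 * Real.pi / ε),
      Real.cos_le_one (2 * Real.pi / ε)]
  rw [Real.norm_eq_abs, Real.norm_eq_abs, abs_of_pos (by positivity : 0 < ε ^ 4)]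
  set T := oscEigenvalue n ε - (Real.pi ^ 2 * n ^ 2 / 2 - Real.pi ^ 2 * n ^ 4 / 64 * ε ^ 2
    + Real.pi * n ^ 4 / 4 * Real.sin (Real.pi / ε) ^ 2 * ε ^ 3) with hT
  set P := 15 * Real.pi ^ 2 * (n : ℝ) ^ 6 / 1024 with hP
  have hP0 : 0 ≤ P := by positivity
  have hle' : |T - (S * ε ^ 5 - P * ε ^ 4)| ≤ C * ε ^ 6 := by
    refine le_of_eq_of_le ?_ hle
    congr 1
    rw [hT]
    ring
  have h6 : ε ^ 6 ≤ ε ^ 4 := pow_le_pow_of_le_one h0.le hε1.2.le (by norm_num)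
  have h5 : ε ^ 5 ≤ ε ^ 4 := pow_le_pow_of_le_one h0.le hε1.2.le (by norm_num)
  have b1 : |S * ε ^ 5| ≤ Real.pi * n ^ 6 * 237 / 1024 * ε ^ 4 := by
    rw [abs_mul, abs_of_pos (by positivity : 0 < ε ^ 5)]
    gcongr
  have b2 : |P * ε ^ 4| = P * ε ^ 4 := abs_of_nonneg (by positivity)
  have b3 : C * ε ^ 6 ≤ |C| * ε ^ 4 := by
    gcongr
    exact le_abs_self C
  have e : T = (T - (S * ε ^ 5 - P * ε ^ 4)) + (S * ε ^ 5 - P * ε ^ 4) := by ring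
  have c1 := abs_add_le (T - (S * ε ^ 5 - P * ε ^ 4)) (S * ε ^ 5 - P * ε ^ 4)
  rw [← e] at c1
  have c2 := abs_sub (S * ε ^ 5) (P * ε ^ 4)
  rw [b2] at c2
  linarith

/-- For E ≥ 0 this is E - a² = (√E - a)(√E + a) with √E + a ≥ a. For E < 0 the convention √E = 0
leaves a² ≤ |E - a²|. -/
theorem abs_sqrt_sub_le {E a : ℝ} (ha : 0 < a) : |Real.sqrt E - a| ≤ |E - a ^ 2| / a := by
  rw [le_div_iff₀ ha]
  rcases le_or_gt 0 E with hE | hE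
  · have h := Real.sq_sqrt hE
    have h0 := Real.sqrt_nonneg E
    rw [show E - a ^ 2 = (Real.sqrt E - a) * (Real.sqrt E + a) by linear_combination (-1) * h,
      abs_mul, abs_of_pos (by linarith : 0 < Real.sqrt E + a)]
    gcongr
    linarith
  · rw [Real.sqrt_eq_zero_of_nonpos hE.le, zero_sub, abs_neg, abs_of_pos ha,
      abs_of_neg (by nlinarith)]
    nlinarith

/-- The expansion of the square root of the `n`-th eigenvalue. -/
theorem sqrt_oscEigenvalue_isBigO {n : ℕ} (hn : 1 ≤ n) :
    (fun ε : ℝ => Real.sqrt (oscEigenvalue n ε) -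
          (Real.pi * n / Real.sqrt 2 - Real.pi * ε ^ 2 * n ^ 3 / (64 * Real.sqrt 2)
            + ε ^ 3 * n ^ 3 * Real.sin (Real.pi / ε) ^ 2 / (4 * Real.sqrt 2)))
      =O[𝓝[>] 0] fun ε : ℝ => ε ^ 4 := by
  obtain ⟨C, hC⟩ := (oscEigenvalue_isBigO hn).bound
  have hpi := Real.pi_pos
  have hn0 : (0 : ℝ) < n := by exact_mod_cast hn
  have h20 : 0 < Real.sqrt 2 := by positivity
  have h2 : Real.sqrt 2 ^ 2 = 2 := Real.sq_sqrt (by norm_num)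
  -- Half the leading term of the expansion `a`; it bounds `a` from below once ε n < 1.
  set m := Real.pi * n / (2 * Real.sqrt 2) with hm
  have hm0 : 0 < m := by positivity
  refine IsBigO.of_bound ((|C| + (Real.pi * n ^ 3 / 64 + n ^ 3 / 4) ^ 2) / m) ?_
  have hlim : Tendsto (fun ε : ℝ => ε ^ 2 * (n : ℝ) ^ 2) (𝓝[>] 0) (𝓝 0) := by
    have : Continuous fun ε : ℝ => ε ^ 2 * (n : ℝ) ^ 2 := by fun_prop
    simpa using (this.tendsto 0).mono_left nhdsWithin_le_nhds
  filter_upwards [hC, Ioo_mem_nhdsGT one_pos, hlim.eventually_lt_const one_pos] with ε hε hε1 hεn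
  have h0 := hε1.1
  obtain ⟨q, hq⟩ : ∃ q, q = Real.sin (Real.pi / ε) ^ 2 := ⟨_, rfl⟩
  have hq0 : 0 ≤ q := by rw [hq]; positivity
  have hq1 : q ≤ 1 := by rw [hq]; exact Real.sin_sq_le_one _
  rw [← hq] at hε ⊢
  set a := Real.pi * n / Real.sqrt 2 - Real.pi * ε ^ 2 * n ^ 3 / (64 * Real.sqrt 2)
    + ε ^ 3 * n ^ 3 * q / (4 * Real.sqrt 2) with ha
  have hma : m ≤ a := by
    have e1 : a - m = Real.pi * n / (64 * Real.sqrt 2) * (32 - ε ^ 2 * n ^ 2)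
        + ε ^ 3 * n ^ 3 * q / (4 * Real.sqrt 2) := by
      rw [ha, hm]
      field_simp
      ring
    have e2 : 0 ≤ Real.pi * n / (64 * Real.sqrt 2) * (32 - ε ^ 2 * n ^ 2) :=
      mul_nonneg (by positivity) (by linarith)
    have e3 : 0 ≤ ε ^ 3 * n ^ 3 * q / (4 * Real.sqrt 2) := by positivity
    linarith
  rw [Real.norm_eq_abs, Real.norm_eq_abs, abs_of_pos (by positivity : 0 < ε ^ 4)] at hε ⊢
  set b := n ^ 3 / 4 * q * ε - Real.pi * n ^ 3 / 64 with hb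
  have hbb : |b| ≤ Real.pi * n ^ 3 / 64 + n ^ 3 / 4 := by
    have : (n : ℝ) ^ 3 / 4 * q * ε ≤ n ^ 3 / 4 * 1 * 1 := by
      gcongr
      exact hε1.2.le
    have : 0 ≤ (n : ℝ) ^ 3 / 4 * q * ε := by positivity
    have : 0 ≤ Real.pi * (n : ℝ) ^ 3 / 64 := by positivity
    rw [abs_le]
    constructor <;> linarith
  -- Writing a = (πn + bε²)/√2, the cross term πn b ε² gives the orders ε² and ε³ of the eigenvalue;
  -- only b²ε⁴/2 is in excess.
  have hsq : a ^ 2 = Real.pi ^ 2 * n ^ 2 / 2 - Real.pi ^ 2 * n ^ 4 / 64 * ε ^ 2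
      + Real.pi * n ^ 4 / 4 * q * ε ^ 3 + b ^ 2 / 2 * ε ^ 4 := by
    have e1 : a = (Real.pi * n + b * ε ^ 2) / Real.sqrt 2 := by
      rw [ha, hb]
      field_simp
      ring
    rw [e1, div_pow, h2, hb]
    ring
  have hEa : |oscEigenvalue n ε - a ^ 2|
      ≤ (|C| + (Real.pi * n ^ 3 / 64 + n ^ 3 / 4) ^ 2) * ε ^ 4 := by
    have c1 := abs_sub (oscEigenvalue n ε - (Real.pi ^ 2 * n ^ 2 / 2
      - Real.pi ^ 2 * n ^ 4 / 64 * ε ^ 2 + Real.pi * n ^ 4 / 4 * q * ε ^ 3)) (b ^ 2 / 2 * ε ^ 4)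
    have c2 : |b ^ 2 / 2 * ε ^ 4| ≤ (Real.pi * n ^ 3 / 64 + n ^ 3 / 4) ^ 2 * ε ^ 4 := by
      rw [abs_of_nonneg (by positivity), ← sq_abs b]
      gcongr
      have : |b| ^ 2 ≤ (Real.pi * n ^ 3 / 64 + n ^ 3 / 4) ^ 2 := by gcongr
      linarith [sq_nonneg |b|]
    have c3 : C * ε ^ 4 ≤ |C| * ε ^ 4 := by
      gcongr
      exact le_abs_self C
    rw [hsq, ← sub_sub]
    linarith
  calc _ ≤ |oscEigenvalue n ε - a ^ 2| / a := abs_sqrt_sub_le (hm0.trans_le hma)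
    _ ≤ (|C| + (Real.pi * n ^ 3 / 64 + n ^ 3 / 4) ^ 2) * ε ^ 4 / m := by gcongr
    _ = _ := by ring

end

theorem mainTheorem4 :
    -- for every `n ≥ 1` and all small `ε > 0`, `E_n(ε)` really is the `n`-th eigenvalue
    (∀ n : ℕ, 1 ≤ n → ∀ᶠ ε : ℝ in 𝓝[>] 0,
      IsNthStringEigenvalue (1 / 2) (oscDensity ε) n (oscEigenvalue n ε)) ∧
    -- the fundamental eigenvalue
    ((fun ε : ℝ => oscEigenvalue 1 ε -
        (Real.pi ^ 2 / 2 - Real.pi ^ 2 / 64 * ε ^ 2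
          + Real.pi / 4 * Real.sin (Real.pi / ε) ^ 2 * ε ^ 3
          - 15 * Real.pi ^ 2 / 1024 * ε ^ 4
          + Real.pi * (5 * Real.sin (4 * Real.pi / ε) - 116 * Real.cos (2 * Real.pi / ε) + 116)
              / 1024 * ε ^ 5))
      =O[𝓝[>] 0] fun ε : ℝ => ε ^ 6) ∧
    -- the `n`-th eigenvalue and its square root
    (∀ n : ℕ, 1 ≤ n →
      ((fun ε : ℝ => oscEigenvalue n ε -
          (Real.pi ^ 2 * n ^ 2 / 2 - Real.pi ^ 2 * n ^ 4 / 64 * ε ^ 2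
            + Real.pi * n ^ 4 / 4 * Real.sin (Real.pi / ε) ^ 2 * ε ^ 3))
        =O[𝓝[>] 0] fun ε : ℝ => ε ^ 4) ∧
      ((fun ε : ℝ => Real.sqrt (oscEigenvalue n ε) -
          (Real.pi * n / Real.sqrt 2 - Real.pi * ε ^ 2 * n ^ 3 / (64 * Real.sqrt 2)
            + ε ^ 3 * n ^ 3 * Real.sin (Real.pi / ε) ^ 2 / (4 * Real.sqrt 2)))
        =O[𝓝[>] 0] fun ε : ℝ => ε ^ 4)) := by
  refine ⟨fun n hn => ?_, ?_, fun n hn =>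
    ⟨oscEigenvalue_isBigO hn, sqrt_oscEigenvalue_isBigO hn⟩⟩
  · obtain ⟨C, hC⟩ := exists_oscEigenvalue_expansion hn
    exact hC.mono fun ε h => h.1
  · obtain ⟨C, hC⟩ := exists_oscEigenvalue_expansion le_rfl
    refine IsBigO.of_bound C ?_
    filter_upwards [hC, self_mem_nhdsWithin] with ε hε h0
    have h0' : 0 < ε := h0
    have hle := hε.2
    simp only [Nat.cast_one, one_pow, mul_one] at hle
    rw [Real.norm_eq_abs, Real.norm_eq_abs, abs_of_pos (by positivity : 0 < ε ^ 6)]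
    exact hle
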